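/- Setting. Consider the 3-fermion anyon theory with anyons $1,\psi_r,\psi_g,\psi_b$ (fusion group $\mathbb Z_2\times\mathbb Z_2$, distinct fermions braid with mutual phase $-1$) and symmetry group $S_3$ permuting the three fermions. A fermion $\alpha$ carried counter-clockwise around a twist $\mathcal T_g$ becomes $g\cdot\alpha$. For $1\neq g\in S_3$ the encoding $\mathcal E_g=\{\mathcal T_g^{(1)},\mathcal T_{g^{-1}}^{(2)},\mathcal T_{g^{-1}}^{(3)},\mathcal T_g^{(4)}\}$ consists of four twists on a line with vacuum total charge; it encodes one qubit if $g$ is a 2-cycle and two qubits if $g$ is a 3-cycle. The logical Pauli operators are fermionic string operators, taken modulo phases and modulo the operators that act trivially on the encoding (loops around a single twist of a charge that this twist condenses, and all loops around the four twists of one encoding); $\overline Z$-type operators are fermion loops around twists $1,2$ and $\overline X$-type operators are fermion loops around twists $1,3$. Place $\mathcal E_g$ and $\mathcal E_h$ side by side ($g,h\neq 1$). A braid $\beta$ on the eight strands drags the string operators along. It preserves the code if it restores the twist configuration and maps the operators that act trivially on the encodings to such operators. It implements a unitary $U$ on the encoded qubits (up to Pauli operators and a phase) if it preserves the code and, for every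 logical Pauli operator $P$, $UPU^\dagger$ equals, up to a phase, the logical Pauli operator to which $\beta$ carries $P$. A gate is entangling if it maps some product state (with respect to the division into the qubits of $\mathcal E_g$ and those of $\mathcal E_h$) to a state that is not a product state. Lemma. Let $g,h\in S_3\setminus\{1\}$. 1. Some braid of the twists of $\mathcal E_g$ and $\mathcal E_h$ implements an entangling gate if and only if $g\neq h$ or at least one of $g,h$ is a 3-cycle. 2. If $g\neq h$ are 2-cycles, then some pure braid implements the controlled-$Z$ gate $CZ$ between the two encoded qubits. 3. If $g=h$ is a 2-cycle, then every braid that preserves the code implements some gate, and every gate $U$ that it implements is of the form $C_1\otimes C_2$ or $(C_1\otimes C_2)\,\mathrm{SWAP}$ with single-qubit Clifford gates $C_1,C_2$, where $\mathrm{SWAP}$ exchanges the two encodings; if the braid returns the twists of the first encoding to the positions of the first encoding, then $U=C_1\otimes C_2$ for some single-qubit Clifford gates $C_1,C_2$. -/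

import Mathlib

open scoped Matrix Kronecker

noncomputable section

namespace ThreeFermion

/-! ### The 3-fermion anyon theory and its symmetry group -/

/-- The three colours: `0 = r`, `1 = g`, `2 = b`. -/
abbrev Colour := Fin 3

/-- The symmetry group `S₃` permuting the three fermion species. -/
abbrev Symm := Equiv.Perm Colour

/-- The anyons `1, ψ_r, ψ_g, ψ_b`. -/
inductive Anyon where
  | vac : Anyon
  | psi : Colour → Anyon
  deriving DecidableEq, Fintype

namespace Anyon

/-- Fusion: `ψ_c × ψ_c = 1`, and two different fermions fuse to the third one
(the three colours add up to `0` modulo `3`). -/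
def fuse : Anyon → Anyon → Anyon
  | vac, y => y
  | psi c, vac => psi c
  | psi c, psi d => if c = d then vac else psi (-(c + d))

instance : Zero Anyon := ⟨vac⟩
instance : Add Anyon := ⟨fuse⟩
instance : Neg Anyon := ⟨fun x => x⟩

/-- The anyons form the fusion group `ℤ₂ × ℤ₂`, written additively. -/
instance : AddCommGroup Anyon where
  add_assoc := by decide
  zero_add := by decide
  add_zero := by decide
  neg_add_cancel := by decide
  add_comm := by decide
  nsmul := nsmulRec
  zsmul := zsmulRec

/-- The symmetry action `g · 1 = 1`, `g · ψ_c = ψ_{g c}`. -/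
def act (g : Symm) : Anyon → Anyon
  | vac => vac
  | psi c => psi (g c)

/-- Mutual statistics: the entry of the modular `S` matrix is `(-1) ^ braiding x y`; braiding one
fermion around a different one gives `-1`. -/
def braiding : Anyon → Anyon → ZMod 2
  | psi c, psi d => if c = d then 0 else 1
  | _, _ => 0

end Anyon

/-! ### Twists on a line and fermionic string operators

The twists sit at positions `0, 1, …, 7` from left to right on a line, and the base point lies below
the line. For each `i` let `x i` be the loop that goes from the base point up to twist `i`,
once counter-clockwise around it, and back. -/

/-- A configuration of eight twists: a fermion `α` carried along `x i` comes back as `g i · α`. -/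
abbrev Config := Fin 8 → Symm

/-- A fermionic string operator (modulo phases and isotopy) in the complement of the twists, in
normal form: for each `i` the charge `a i` is emitted at the base point and carried along `x i`.
Composition of operators is addition. -/
abbrev StringOp := Fin 8 → Anyon

/-- No charge is left at the base point, i.e. the string-net is closed. -/
def IsClosed (g : Config) (a : StringOp) : Prop :=
  ∑ i, (Anyon.act (g i) (a i) - a i) = 0

/-- The loop operator that carries a fermion of initial type `c` counter-clockwise around the twists
in the list, in the order of the list (each along its own `x i`). -/
def loop (g : Config) : List (Fin 8) → Anyon → StringOp
  | [], _ => 0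
  | i :: w, c => Pi.single i c + loop g w (Anyon.act (g i) c)

/-- Closed string operators `a`, `b` commute up to the sign `(-1) ^ commutator g a b`: every
crossing of the two string-nets contributes the mutual statistics of the crossing charges
(the base point of `b` is moved slightly to the right of that of `a`). -/
def commutator (g : Config) (a b : StringOp) : ZMod 2 :=
  ∑ i, Anyon.braiding (a i) (Anyon.act (g i) (b i) - b i) +
    ∑ i, ∑ j, if j < i then
      Anyon.braiding (Anyon.act (g i) (a i) - a i) (Anyon.act (g j) (b j) - b j) else 0

/-! ### Braiding -/

/-- The counter-clockwise exchange of the twists at positions `i` and `i + 1`: the left one moves to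
the right passing below the other one. It maps `x i` to `x (i+1)`, and `x (i+1)` to the loop that
runs along `x (i+1)`, then `x i`, then backwards along `x (i+1)`. String operators are dragged along
with the twists. -/
def exchange (i : Fin 7) (s : Config × StringOp) : Config × StringOp :=
  let p : Fin 8 := i.castSucc
  let q : Fin 8 := i.succ
  (Function.update (Function.update s.1 p (s.1 p * s.1 q * (s.1 p)⁻¹)) q (s.1 p),
   Function.update (Function.update s.2 p (Anyon.act (s.1 p) (s.2 q)))
     q (s.2 p + s.2 q + Anyon.act (s.1 q) (s.2 q)))

/-- The clockwise exchange of the twists at positions `i` and `i + 1`, the inverse of `exchange`. -/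
def exchangeInv (i : Fin 7) (s : Config × StringOp) : Config × StringOp :=
  let p : Fin 8 := i.castSucc
  let q : Fin 8 := i.succ
  (Function.update (Function.update s.1 p (s.1 q)) q ((s.1 q)⁻¹ * s.1 p * s.1 q),
   Function.update (Function.update s.2 p
     (s.2 q + Anyon.act (s.1 q)⁻¹ (s.2 p) + Anyon.act ((s.1 q)⁻¹ * s.1 p) (s.2 p)))
     q (Anyon.act (s.1 q)⁻¹ (s.2 p)))

/-- A braid on eight strands, as a word in the standard generators and their inverses: `(i, true)`
is the counter-clockwise exchange of positions `i`, `i + 1`, and `(i, false)` the clockwise one. The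
first letter is carried out first. -/
abbrev Braid := List (Fin 7 × Bool)

/-- Effect of a braid on a twist configuration together with a string operator. -/
def Braid.apply : Braid → Config × StringOp → Config × StringOp
  | [], s => s
  | (i, true) :: β, s => Braid.apply β (exchange i s)
  | (i, false) :: β, s => Braid.apply β (exchangeInv i s)

/-- The twist configuration after the braid. -/
def Braid.config (β : Braid) (g : Config) : Config := (β.apply (g, 0)).1

/-- The string operator `a`, in the presence of the configuration `g`, after the braid. -/
def Braid.move (β : Braid) (g : Config) (a : StringOp) : StringOp := (β.apply (g, a)).2

/-- The permutation induced by a braid: the strand that starts at `k` ends at `β.perm k`. -/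
def Braid.perm : Braid → Equiv.Perm (Fin 8)
  | [] => 1
  | (i, _) :: β => Braid.perm β * Equiv.swap (i.castSucc : Fin 8) (i.succ : Fin 8)

/-! ### The encodings `E_g`, `E_h` and their logical Pauli operators -/

/-- Two encodings side by side: `T_g, T_{g⁻¹}, T_{g⁻¹}, T_g, T_h, T_{h⁻¹}, T_{h⁻¹}, T_h`. -/
def pairConfig (g h : Symm) : Config := ![g, g⁻¹, g⁻¹, g, h, h⁻¹, h⁻¹, h]

/-- The number of qubits of `E_g` for `g ≠ 1`: one for a 2-cycle (which fixes a colour), two for a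
3-cycle (which fixes none). -/
def numQubits (g : Symm) : ℕ := if ∃ c, g c = c then 1 else 2

/-- The string operators that act as the identity (up to a sign) on the encoded states: a loop
around a single twist of a charge that the twist can condense, and any loop around all four twists
of one encoding, since each encoding has vacuum total charge. -/
def stabilizer (g h : Symm) : AddSubgroup StringOp :=
  AddSubgroup.closure
    ({a | ∃ (i : Fin 8) (c : Anyon), Anyon.act (pairConfig g h i) c = c ∧ a = Pi.single i c} ∪
     {a | ∃ c : Anyon, a = loop (pairConfig g h) [3, 2, 1, 0] c} ∪
     {a | ∃ c : Anyon, a = loop (pairConfig g h) [7, 6, 5, 4] c})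

/-- The charge whose loop around the first and second twist of `E_g` is the logical `Z` of qubit
`j`. For a 2-cycle any fermion moved by `g` can be used. -/
def zCharge (g : Symm) (j : ℕ) : Anyon :=
  if ∃ c, g c = c then Anyon.psi (if g 0 ≠ 0 then 0 else 1)
  else Anyon.psi (if j = 0 then 0 else 1)

/-- The charge whose loop around the first and third twist of `E_g` is the logical `X` of qubit
`j`. For a 3-cycle it is fixed by the requirement of canonical commutation relations. -/
def xCharge (g : Symm) (j : ℕ) : Anyon :=
  if ∃ c, g c = c then zCharge g 0
  else Anyon.act g⁻¹ (Anyon.psi (if j = 0 then 1 else 0))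

/-- Logical `X` of the `j`-th qubit of the encoding by `g` whose first twist is at position `o`. -/
def logicalX (f : Config) (o : Fin 8) (g : Symm) (j : ℕ) : StringOp :=
  loop f [o + 2, o] (xCharge g j)

/-- Logical `Z` of the `j`-th qubit of the encoding by `g` whose first twist is at position `o`. -/
def logicalZ (f : Config) (o : Fin 8) (g : Symm) (j : ℕ) : StringOp :=
  loop f [o + 1, o] (zCharge g j)

/-- The logical operators are closed and have the commutation relations of Pauli operators. -/
theorem logical_relations : ∀ g h : Symm, g ≠ 1 → h ≠ 1 →
    let f := pairConfig g h
    (∀ i : Fin (numQubits g), IsClosed f (logicalX f 0 g i) ∧ IsClosed f (logicalZ f 0 g i)) ∧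
    (∀ i : Fin (numQubits h), IsClosed f (logicalX f 4 h i) ∧ IsClosed f (logicalZ f 4 h i)) ∧
    (∀ i j : Fin (numQubits g),
      commutator f (logicalX f 0 g i) (logicalZ f 0 g j) = (if i = j then 1 else 0) ∧
      commutator f (logicalX f 0 g i) (logicalX f 0 g j) = 0 ∧
      commutator f (logicalZ f 0 g i) (logicalZ f 0 g j) = 0) ∧
    (∀ i j : Fin (numQubits h),
      commutator f (logicalX f 4 h i) (logicalZ f 4 h j) = (if i = j then 1 else 0) ∧
      commutator f (logicalX f 4 h i) (logicalX f 4 h j) = 0 ∧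
      commutator f (logicalZ f 4 h i) (logicalZ f 4 h j) = 0) ∧
    (∀ (i : Fin (numQubits g)) (j : Fin (numQubits h)),
      commutator f (logicalX f 0 g i) (logicalX f 4 h j) = 0 ∧
      commutator f (logicalX f 0 g i) (logicalZ f 4 h j) = 0 ∧
      commutator f (logicalZ f 0 g i) (logicalX f 4 h j) = 0 ∧
      commutator f (logicalZ f 0 g i) (logicalZ f 4 h j) = 0) := by
  unfold IsClosed
  decide +kernel

/-- Exponents `(p, q)` of a Pauli operator `X^p Z^q` on `k` qubits. -/
abbrev PauliLabel (k : ℕ) := (Fin k → ZMod 2) × (Fin k → ZMod 2)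

/-- The string operator of the logical Pauli operator `X^p Z^q` of one encoding. -/
def blockPauli (f : Config) (o : Fin 8) (g : Symm) (v : PauliLabel (numQubits g)) : StringOp :=
  ∑ j, ((v.1 j).val • logicalX f o g j + (v.2 j).val • logicalZ f o g j)

/-- The string operator of a logical Pauli operator of the two encodings. -/
def logicalPauli (g h : Symm) (v : PauliLabel (numQubits g)) (w : PauliLabel (numQubits h)) :
    StringOp :=
  blockPauli (pairConfig g h) 0 g v + blockPauli (pairConfig g h) 4 h w

/-! ### Qubits, gates and their implementation by braids -/

/-- Computational basis of `k` qubits. -/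
abbrev Bits (k : ℕ) := Fin k → ZMod 2

/-- The Pauli matrix `X^p Z^q`, that is `|y⟩ ↦ (-1)^{q·y} |y + p⟩`. -/
def pauli {k : ℕ} (v : PauliLabel k) : Matrix (Bits k) (Bits k) ℂ :=
  fun x y => if x = y + v.1 then (-1) ^ (v.2 ⬝ᵥ y).val else 0

/-- Operators on the qubits of both encodings, as matrices in the computational basis. -/
abbrev Gate (k l : ℕ) := Matrix (Bits k × Bits l) (Bits k × Bits l) ℂ

/-- Controlled-`Z` between qubit `i` of the first and qubit `j` of the second encoding. -/
def gateCZ {k l : ℕ} (i : Fin k) (j : Fin l) : Gate k l :=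
  Matrix.diagonal fun x => (-1) ^ (x.1 i * x.2 j).val

/-- The gate that exchanges two equally large encodings. -/
def gateSwap (k : ℕ) : Gate k k := fun x y => if x.1 = y.2 ∧ x.2 = y.1 then 1 else 0

/-- Clifford gates: unitaries that normalise the Pauli group. -/
def IsClifford {k : ℕ} (C : Matrix (Bits k) (Bits k) ℂ) : Prop :=
  C ∈ Matrix.unitaryGroup (Bits k) ℂ ∧
    ∀ v, ∃ v' : PauliLabel k, ∃ z : ℂ, ‖z‖ = 1 ∧ C * pauli v * Cᴴ = z • pauli v'

/-- A gate is entangling (between the two encodings) if it maps some product state to a state that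
is not a product state. -/
def IsEntangling {k l : ℕ} (U : Gate k l) : Prop :=
  ∃ (ψ : Bits k → ℂ) (φ : Bits l → ℂ), ∀ (ψ' : Bits k → ℂ) (φ' : Bits l → ℂ),
    U *ᵥ (fun x => ψ x.1 * φ x.2) ≠ fun x => ψ' x.1 * φ' x.2

/-- The braid maps the encoded space to itself (up to a Pauli correction): it restores the twist
configuration and the group of string operators fixed by the encoding. -/
structure PreservesCode (g h : Symm) (β : Braid) : Prop where
  config_eq : β.config (pairConfig g h) = pairConfig g h
  stabilizer_mem : ∀ a ∈ stabilizer g h, β.move (pairConfig g h) a ∈ stabilizer g h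

/-- The braid `β` of the twists of `E_g` and `E_h` implements the gate `U` (up to Pauli operators
and a phase): `β` preserves the encoded space, and `U` conjugates the logical Pauli
operators, up to phases, in the way in which `β` moves the string operators representing them. -/
structure Implements (g h : Symm) (β : Braid) (U : Gate (numQubits g) (numQubits h)) : Prop where
  preserves : PreservesCode g h β
  unitary : U ∈ Matrix.unitaryGroup (Bits (numQubits g) × Bits (numQubits h)) ℂ
  conj : ∀ v w, ∃ v' w', ∃ z : ℂ, ‖z‖ = 1 ∧
    β.move (pairConfig g h) (logicalPauli g h v w) - logicalPauli g h v' w' ∈ stabilizer g h ∧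
    U * (pauli v ⊗ₖ pauli w) * Uᴴ = z • (pauli v' ⊗ₖ pauli w')

end ThreeFermion

end

open scoped Matrix Kronecker

noncomputable section

namespace ThreeFermion

/-! ### Linearity of the action of braids -/

/-! For a fixed initial configuration a braid acts linearly on string operators over the field with
two elements (`Braid.move_add`), so its effect on the logical Pauli operators is a question of
linear algebra modulo the stabilizer.

Entangling gates come from one pure braid, `pairBraid`, which carries twists 1, 2 of the first
encoding around twists 1, 2 of the second. Each pair has trivial total holonomy, so the
configuration returns, and the only effect is that the charge which an operator transports through
one pair is added as a loop around the other pair (`pairBraid_apply`). Stabilizers and logical Z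
operators transport nothing and stay fixed; a logical X acquires logical Z operators of the other
encoding, with coefficients `coupling`. This is conjugation by a product of CZ gates
(`phaseGate_conj`). An X loop of a 2-cycle transports the fermion which that 2-cycle fixes, so the
added loop is condensed if the other encoding uses the same 2-cycle; in all other cases some
coefficient is nonzero (`exists_coupling_ne_zero`), and one nonzero coefficient already entangles
the uniform superposition (`phaseGate_isEntangling`).

For equal 2-cycles, all eight twists carry the same involution. Modulo condensed charges a string
operator only records which twists it encircles, and every braid acts on this record through its
permutation (`reduce_move`). The stabilizer consists of the vectors constant on each block of four,
so preserving it forces blocks to go to blocks (`PreservesCode.exists_perm`). The logical Paulis of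
a block are the even vectors modulo the all-ones vector, and permutations of four twists act there
by Clifford gates (`exists_conjugates_permLabel`). Two unitaries implementing the same braid differ
by one that fixes all Paulis up to phase, hence by a product gate
(`exists_kronecker_of_conj_pauli`), so no implemented gate can entangle. -/

theorem Anyon.act_add : ∀ (g : Symm) (x y : Anyon),
    Anyon.act g (x + y) = Anyon.act g x + Anyon.act g y := by decide +kernel

theorem Anyon.act_zero (g : Symm) : Anyon.act g 0 = 0 := rfl

theorem Anyon.add_self : ∀ x : Anyon, x + x = 0 := by decide

theorem exchange_snd_add (i : Fin 7) (g : Config) (a b : StringOp) :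
    (exchange i (g, a + b)).2 = (exchange i (g, a)).2 + (exchange i (g, b)).2 := by
  funext j
  simp only [exchange, Function.update_apply, Pi.add_apply, Anyon.act_add]
  split_ifs
  · abel
  · rfl
  · rfl

theorem exchangeInv_snd_add (i : Fin 7) (g : Config) (a b : StringOp) :
    (exchangeInv i (g, a + b)).2 = (exchangeInv i (g, a)).2 + (exchangeInv i (g, b)).2 := by
  funext j
  simp only [exchangeInv, Function.update_apply, Pi.add_apply, Anyon.act_add]
  split_ifs
  · rfl
  · abel
  · rfl

/-- One letter of a braid word. -/
def letter (x : Fin 7 × Bool) (s : Config × StringOp) : Config × StringOp :=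
  if x.2 then exchange x.1 s else exchangeInv x.1 s

theorem Braid.apply_cons (x : Fin 7 × Bool) (β : Braid) (s : Config × StringOp) :
    Braid.apply (x :: β) s = Braid.apply β (letter x s) := by
  obtain ⟨i, _ | _⟩ := x <;> rfl

theorem letter_fst (x : Fin 7 × Bool) (g : Config) (a b : StringOp) :
    (letter x (g, a)).1 = (letter x (g, b)).1 := by
  obtain ⟨i, _ | _⟩ := x <;> rfl

theorem letter_snd_add (x : Fin 7 × Bool) (g : Config) (a b : StringOp) :
    (letter x (g, a + b)).2 = (letter x (g, a)).2 + (letter x (g, b)).2 := by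
  obtain ⟨i, _ | _⟩ := x
  · exact exchangeInv_snd_add i g a b
  · exact exchange_snd_add i g a b

/-- The twists evolve independently of the string operator, so each letter is additive for the
configuration it meets; the induction must therefore vary the configuration. -/
theorem Braid.move_add (β : Braid) (g : Config) (a b : StringOp) :
    β.move g (a + b) = β.move g a + β.move g b := by
  induction β generalizing g a b with
  | nil => rfl
  | cons x β ih =>
    have key : ∀ c, Braid.move (x :: β) g c
        = Braid.move β (letter x (g, 0)).1 (letter x (g, c)).2 := fun c => by
      rw [Braid.move, Braid.apply_cons, Braid.move, letter_fst x g 0 c]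
    rw [key, key, key, letter_snd_add, ih]

/-- The action of a braid on string operators, as an additive map. -/
def Braid.moveHom (β : Braid) (g : Config) : StringOp →+ StringOp :=
  AddMonoidHom.mk' (β.move g) (β.move_add g)

theorem Braid.moveHom_apply (β : Braid) (g : Config) (a : StringOp) :
    β.moveHom g a = β.move g a := rfl

/-! ### A decidable description of the stabilizer -/

/-- After removal of the loops around the two encodings that are determined by the charges at the
last twists, only condensed charges are left. -/
def IsTrivial (g h : Symm) (a : StringOp) : Prop :=
  ∀ i, Anyon.act (pairConfig g h i) ((a - loop (pairConfig g h) [3, 2, 1, 0] (a 3) -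
      loop (pairConfig g h) [7, 6, 5, 4] (a 7)) i) =
    (a - loop (pairConfig g h) [3, 2, 1, 0] (a 3) - loop (pairConfig g h) [7, 6, 5, 4] (a 7)) i

instance (g h : Symm) (a : StringOp) : Decidable (IsTrivial g h a) := by
  unfold IsTrivial; infer_instance

/-- Turns membership in a generated subgroup into a criterion that can be evaluated; only this
direction is needed for the finite checks. -/
theorem IsTrivial.mem {g h : Symm} {a : StringOp} (ha : IsTrivial g h a) :
    a ∈ stabilizer g h := by
  set f := pairConfig g h with hf
  set r := a - loop f [3, 2, 1, 0] (a 3) - loop f [7, 6, 5, 4] (a 7) with hr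
  have h1 : loop f [3, 2, 1, 0] (a 3) ∈ stabilizer g h :=
    AddSubgroup.subset_closure (Or.inl (Or.inr ⟨a 3, rfl⟩))
  have h2 : loop f [7, 6, 5, 4] (a 7) ∈ stabilizer g h :=
    AddSubgroup.subset_closure (Or.inr ⟨a 7, rfl⟩)
  have h3 : r ∈ stabilizer g h := by
    rw [← Finset.univ_sum_single r]
    exact sum_mem fun i _ => AddSubgroup.subset_closure (Or.inl (Or.inl ⟨i, r i, ha i, rfl⟩))
  have h4 : r + loop f [3, 2, 1, 0] (a 3) + loop f [7, 6, 5, 4] (a 7) = a := by rw [hr]; abel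
  exact h4 ▸ add_mem (add_mem h3 h1) h2

/-! ### Controlled-phase gates -/

theorem neg_one_pow_val_add (a b : ZMod 2) :
    (-1 : ℂ) ^ (a + b).val = (-1) ^ a.val * (-1) ^ b.val := by
  revert a b
  have : ∀ a b : ZMod 2, (a + b).val % 2 = (a.val + b.val) % 2 := by decide
  intro a b
  rw [← pow_add, neg_one_pow_eq_pow_mod_two, this, ← neg_one_pow_eq_pow_mod_two]

theorem neg_one_pow_val_mul_self (a : ZMod 2) : ((-1 : ℂ) ^ a.val) * (-1) ^ a.val = 1 := by
  rw [← neg_one_pow_val_add, CharTwo.add_self_eq_zero]; simp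

/-- The product of the controlled-`Z` gates prescribed by a matrix over `𝔽₂`. -/
def phaseGate {k l : ℕ} (B : Matrix (Fin k) (Fin l) (ZMod 2)) : Gate k l :=
  Matrix.diagonal fun x => (-1) ^ (x.1 ⬝ᵥ B *ᵥ x.2).val

theorem phaseGate_conjTranspose {k l : ℕ} (B : Matrix (Fin k) (Fin l) (ZMod 2)) :
    (phaseGate B)ᴴ = phaseGate B := by
  rw [phaseGate, Matrix.diagonal_conjTranspose]
  congr 1
  funext x
  simp

theorem phaseGate_mul_self {k l : ℕ} (B : Matrix (Fin k) (Fin l) (ZMod 2)) :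
    phaseGate B * phaseGate B = 1 := by
  rw [phaseGate, Matrix.diagonal_mul_diagonal, ← Matrix.diagonal_one]
  congr 1
  funext x
  exact neg_one_pow_val_mul_self _

theorem phaseGate_mem_unitaryGroup {k l : ℕ} (B : Matrix (Fin k) (Fin l) (ZMod 2)) :
    phaseGate B ∈ Matrix.unitaryGroup (Bits k × Bits l) ℂ := by
  rw [Matrix.mem_unitaryGroup_iff, Matrix.star_eq_conjTranspose, phaseGate_conjTranspose,
    phaseGate_mul_self]

/-- Polarization of the bilinear exponent: shifting both arguments produces two linear terms, which
are the new Z exponents, and a constant, which is the phase. -/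
theorem phaseGate_conj {k l : ℕ} (B : Matrix (Fin k) (Fin l) (ZMod 2))
    (v : PauliLabel k) (w : PauliLabel l) :
    phaseGate B * (pauli v ⊗ₖ pauli w) * (phaseGate B)ᴴ =
      ((-1 : ℂ) ^ (v.1 ⬝ᵥ B *ᵥ w.1).val) •
        (pauli (v.1, v.2 + B *ᵥ w.1) ⊗ₖ pauli (w.1, w.2 + v.1 ᵥ* B)) := by
  ext ⟨x, x'⟩ ⟨y, y'⟩
  rw [phaseGate_conjTranspose, phaseGate, Matrix.mul_diagonal, Matrix.diagonal_mul]
  simp only [Matrix.kroneckerMap_apply, Matrix.smul_apply, smul_eq_mul, pauli]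
  by_cases h1 : x = y + v.1
  · by_cases h2 : x' = y' + w.1
    · simp only [h1, h2, if_true, ← neg_one_pow_val_add]
      congr 2
      simp only [Matrix.mulVec_add, add_dotProduct, dotProduct_add, ← Matrix.dotProduct_mulVec,
        dotProduct_comm (B *ᵥ w.1) y]
      -- The unshifted form occurs once from each side of the conjugation and cancels in
      -- characteristic 2.
      have := CharTwo.add_self_eq_zero (y ⬝ᵥ B *ᵥ y')
      linear_combination this
    · simp [h2]
  · simp [h1]

theorem gateCZ_eq_phaseGate {k l : ℕ} [Subsingleton (Fin k)] [Subsingleton (Fin l)]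
    (i : Fin k) (j : Fin l) (B : Matrix (Fin k) (Fin l) (ZMod 2)) (hB : B i j = 1) :
    gateCZ i j = phaseGate B := by
  rw [gateCZ, phaseGate]
  congr 1
  funext x
  congr 2
  simp [dotProduct, Matrix.mulVec, Fintype.sum_subsingleton _ i, Fintype.sum_subsingleton _ j, hB]

/-- On the all-ones vector, the amplitudes at 0 and the unit vectors `i`, `j` form the matrix with
rows (1, 1) and (1, -1), which has rank two. -/
theorem phaseGate_isEntangling {k l : ℕ} (B : Matrix (Fin k) (Fin l) (ZMod 2)) {i : Fin k}
    {j : Fin l} (hB : B i j ≠ 0) : IsEntangling (phaseGate B) := by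
  refine ⟨1, 1, fun ψ φ H => ?_⟩
  have H' : ∀ x y, (-1 : ℂ) ^ (x ⬝ᵥ B *ᵥ y).val = ψ x * φ y := fun x y => by
    have := congrFun H (x, y)
    simpa [phaseGate, Matrix.mulVec_diagonal] using this
  have hB' : B i j = 1 := by
    have : ∀ b : ZMod 2, b ≠ 0 → b = 1 := by decide
    exact this _ hB
  have h00 := H' 0 0
  have h01 := H' 0 (Pi.single j 1)
  have h10 := H' (Pi.single i 1) 0
  have h11 := H' (Pi.single i 1) (Pi.single j 1)
  simp [hB'] at h00 h01 h10 h11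
  have h1 : (ZMod.val (1 : ZMod 2)) = 1 := rfl
  rw [h1] at h11
  have : (1 : ℂ) * 1 = 1 * -1 := by
    calc (1 : ℂ) * 1 = (ψ 0 * φ (Pi.single j 1)) * (ψ (Pi.single i 1) * φ 0) := by
          rw [← h01, ← h10]
      _ = (ψ 0 * φ 0) * (ψ (Pi.single i 1) * φ (Pi.single j 1)) := by ring
      _ = 1 * -1 := by rw [← h00, ← h11]; norm_num
  norm_num at this

/-! ### A pure braid that couples the two encodings -/

theorem Anyon.act_act (g h : Symm) (x : Anyon) :
    Anyon.act g (Anyon.act h x) = Anyon.act (g * h) x := by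
  cases x <;> rfl

theorem Anyon.act_one (x : Anyon) : Anyon.act 1 x = x := by
  cases x <;> rfl

theorem exchangeInv_exchange (i : Fin 7) (s : Config × StringOp) :
    exchangeInv i (exchange i s) = s := by
  have hne : (i.castSucc : Fin 8) ≠ i.succ := Fin.castSucc_lt_succ.ne
  refine Prod.ext (funext fun j => ?_) (funext fun j => ?_) <;>
  · by_cases h1 : j = i.succ
    · subst h1
      simp [exchange, exchangeInv, hne, Anyon.act_act, mul_assoc, Anyon.act_one]
    · by_cases h2 : j = i.castSucc
      · subst h2
        simp [exchange, exchangeInv, hne, Anyon.act_act, mul_assoc, Anyon.act_one, add_comm,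
          add_left_comm, Anyon.add_self]
      · simp [exchange, exchangeInv, h1, h2]

theorem Braid.apply_append (β γ : Braid) (s : Config × StringOp) :
    Braid.apply (β ++ γ) s = Braid.apply γ (Braid.apply β s) := by
  induction β generalizing s with
  | nil => rfl
  | cons x β ih => rw [List.cons_append, Braid.apply_cons, Braid.apply_cons, ih]

/-- The charge that a string operator transports through the first pair of a configuration. -/
def pairCharge (g : Symm) (x y : Anyon) : Anyon :=
  x + Anyon.act g x + (y + Anyon.act g⁻¹ y)

/-- The added term is a loop around the whole pair; its holonomy is trivial, so such a loop
transports no charge. -/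
theorem pairCharge_add (g : Symm) (x y E : Anyon) :
    pairCharge g (x + Anyon.act g⁻¹ E) (y + E) = pairCharge g x y := by
  have h : pairCharge g (x + Anyon.act g⁻¹ E) (y + E) = pairCharge g x y +
      ((E + E) + (Anyon.act g⁻¹ E + Anyon.act g⁻¹ E)) := by
    simp only [pairCharge, Anyon.act_add, Anyon.act_act, mul_inv_cancel, Anyon.act_one]
    abel
  rw [h, Anyon.add_self, Anyon.add_self, add_zero, add_zero]

/-- Two neighbouring pairs of twists with trivial total holonomy change places. -/
theorem apply_swapPairs_first (u v : Symm) (x : Fin 4 → Symm) (a : StringOp) (D : Anyon)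
    (hD : D = pairCharge v (a 2) (a 3)) :
    Braid.apply [(1, true), (0, true), (2, true), (1, true)]
      (![u, u⁻¹, v, v⁻¹, x 0, x 1, x 2, x 3], a) =
      (![v, v⁻¹, u, u⁻¹, x 0, x 1, x 2, x 3],
        ![a 2, a 3, a 0 + Anyon.act u⁻¹ D, a 1 + D, a 4, a 5, a 6, a 7]) := by
  subst hD
  refine Prod.ext (funext fun j => ?_) (funext fun j => ?_) <;>
  · fin_cases j <;>
    simp [Braid.apply, exchange, pairCharge, Fin.ext_iff, mul_assoc, Anyon.act_add,
      Anyon.act_act, Anyon.act_one, add_assoc]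

theorem apply_swapPairs_middle (u v : Symm) (x : Fin 4 → Symm) (a : StringOp) (D : Anyon)
    (hD : D = pairCharge v (a 4) (a 5)) :
    Braid.apply [(3, true), (2, true), (4, true), (3, true)]
      (![x 0, x 1, u, u⁻¹, v, v⁻¹, x 2, x 3], a) =
      (![x 0, x 1, v, v⁻¹, u, u⁻¹, x 2, x 3],
        ![a 0, a 1, a 4, a 5, a 2 + Anyon.act u⁻¹ D, a 3 + D, a 6, a 7]) := by
  subst hD
  refine Prod.ext (funext fun j => ?_) (funext fun j => ?_) <;>
  · fin_cases j <;>
    simp [Braid.apply, exchange, pairCharge, Fin.ext_iff, mul_assoc, Anyon.act_add,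
      Anyon.act_act, Anyon.act_one, add_assoc]

/-- The first two twists of the first encoding are carried once around the first two twists of the
second encoding. -/
def pairBraid : Braid :=
  [(1, true), (0, true), (2, true), (1, true)] ++ ([(3, true), (2, true), (4, true), (3, true)] ++
  ([(3, true), (2, true), (4, true), (3, true)] ++
    [(1, false), (2, false), (0, false), (1, false)]))

/-- The string operator obtained from `a` by `pairBraid`. -/
def pairMove (g h : Symm) (a : StringOp) : StringOp :=
  let E := pairCharge h (a 4) (a 5)
  let F := pairCharge g (a 0) (a 1)
  ![a 0 + Anyon.act g⁻¹ E, a 1 + E, a 2, a 3, a 4 + Anyon.act h⁻¹ F, a 5 + F, a 6, a 7]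

theorem pairBraid_apply (g h : Symm) (a : StringOp) :
    pairBraid.apply (pairConfig g h, a) = (pairConfig g h, pairMove g h a) := by
  have hinv : ∀ t, Braid.apply [(1, false), (2, false), (0, false), (1, false)]
      (Braid.apply [(1, true), (0, true), (2, true), (1, true)] t) = t := fun t => by
    simp [Braid.apply, exchangeInv_exchange]
  have h1 := fun b => apply_swapPairs_first g g⁻¹ ![h, h⁻¹, h⁻¹, h] b _ rfl
  have h2 := fun b => apply_swapPairs_middle g h ![g⁻¹, g, h⁻¹, h] b _ rfl
  have h3 := fun b => apply_swapPairs_middle h g ![g⁻¹, g, h⁻¹, h] b _ rfl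
  simp only [inv_inv, Matrix.cons_val] at h1 h2 h3
  -- The final inverse swap is never computed: the target is rewritten as this inverse applied to
  -- the forward swap of the target. Loops picked up on the way do not alter the transported
  -- charges, by `pairCharge_add`.
  rw [pairBraid, Braid.apply_append, Braid.apply_append, Braid.apply_append, pairConfig, h1, h2,
    h3, ← hinv (_, pairMove g h a), h1]
  simp only [pairMove, Matrix.cons_val, pairCharge_add, add_right_comm]

theorem pairBraid_perm : pairBraid.perm = 1 := by decide +kernel

theorem pairBraid_config (g h : Symm) :
    pairBraid.config (pairConfig g h) = pairConfig g h := by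
  rw [Braid.config, pairBraid_apply]

theorem pairBraid_move (g h : Symm) (a : StringOp) :
    pairBraid.move (pairConfig g h) a = pairMove g h a := by
  rw [Braid.move, pairBraid_apply]

theorem pairMove_eq_self (g h : Symm) (a : StringOp) (h1 : pairCharge g (a 0) (a 1) = 0)
    (h2 : pairCharge h (a 4) (a 5) = 0) : pairMove g h a = a := by
  simp only [pairMove, h1, h2, Anyon.act_zero, add_zero]
  funext i
  fin_cases i <;> rfl

theorem pairCharge_act_inv (g : Symm) (x : Anyon) : pairCharge g (Anyon.act g⁻¹ x) x = 0 := by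
  have := pairCharge_add g 0 0 x
  rw [zero_add, zero_add] at this
  exact this

theorem pairCharge_zero (g : Symm) : pairCharge g 0 0 = 0 := rfl

theorem pairMove_condensed (g h : Symm) (i : Fin 8) (c : Anyon)
    (hc : Anyon.act (pairConfig g h i) c = c) :
    pairMove g h (Pi.single i c) = Pi.single i c := by
  have key : ∀ u : Symm, (Anyon.act u c = c → pairCharge u c 0 = 0) ∧
      (Anyon.act u⁻¹ c = c → pairCharge u 0 c = 0) := fun u => by
    constructor <;> intro hu <;> simp [pairCharge, hu, Anyon.act_zero, Anyon.add_self]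
  apply pairMove_eq_self
  · fin_cases i
    · exact (key g).1 hc
    · exact (key g).2 hc
    all_goals rfl
  · fin_cases i
    · rfl
    · rfl
    · rfl
    · rfl
    · exact (key h).1 hc
    · exact (key h).2 hc
    · rfl
    · rfl

theorem pairMove_loop_first (g h : Symm) (c : Anyon) :
    pairMove g h (loop (pairConfig g h) [3, 2, 1, 0] c) =
      loop (pairConfig g h) [3, 2, 1, 0] c := by
  apply pairMove_eq_self
  -- The charge with which the loop, after passing twists 3 and 2, arrives at twist 1.
  · have := pairCharge_act_inv g (Anyon.act g⁻¹ (Anyon.act g c))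
    simpa [loop, pairConfig, Pi.single_apply, Fin.ext_iff] using this
  · simp [loop, Fin.ext_iff, pairCharge_zero]

theorem pairMove_loop_second (g h : Symm) (c : Anyon) :
    pairMove g h (loop (pairConfig g h) [7, 6, 5, 4] c) =
      loop (pairConfig g h) [7, 6, 5, 4] c := by
  apply pairMove_eq_self
  · simp [loop, Fin.ext_iff, pairCharge_zero]
  · have := pairCharge_act_inv h (Anyon.act h⁻¹ (Anyon.act h c))
    simpa [loop, pairConfig, Pi.single_apply, Fin.ext_iff] using this

theorem pairMove_logicalZ_first (g h : Symm) (i : ℕ) :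
    pairMove g h (logicalZ (pairConfig g h) 0 g i) = logicalZ (pairConfig g h) 0 g i := by
  apply pairMove_eq_self
  · have := pairCharge_act_inv g (zCharge g i)
    simpa [logicalZ, loop, pairConfig, Pi.single_apply, Fin.ext_iff] using this
  · simp [logicalZ, loop, Fin.ext_iff, pairCharge_zero]

theorem pairMove_logicalZ_second (g h : Symm) (j : ℕ) :
    pairMove g h (logicalZ (pairConfig g h) 4 h j) = logicalZ (pairConfig g h) 4 h j := by
  apply pairMove_eq_self
  · have : ((4 : Fin 8) + 1) = 5 := rfl
    simp [logicalZ, loop, this, Fin.ext_iff, pairCharge_zero]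
  · have h5 : ((4 : Fin 8) + 1) = 5 := rfl
    have := pairCharge_act_inv h (zCharge h j)
    simpa [logicalZ, loop, h5, pairConfig, Pi.single_apply, Fin.ext_iff] using this

/-- The commutators of the dragged `X` operators with the original ones. -/
def coupling (g h : Symm) (i : Fin (numQubits g)) (j : Fin (numQubits h)) : ZMod 2 :=
  commutator (pairConfig g h) (pairMove g h (logicalX (pairConfig g h) 0 g i))
    (logicalX (pairConfig g h) 4 h j)

/-- A finite check. An X loop transports a sum of the form c + g⁻¹c; the loop this leaves around the
other pair is harmless if that pair condenses the sum, as happens for equal 2-cycles. -/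
theorem exists_coupling_ne_zero : ∀ g h : Symm, g ≠ 1 → h ≠ 1 →
    (g ≠ h ∨ numQubits g = 2 ∨ numQubits h = 2) →
      ∃ (i : Fin (numQubits g)) (j : Fin (numQubits h)), coupling g h i j ≠ 0 := by
  decide +kernel

theorem pairMove_logicalX_first : ∀ g h : Symm, g ≠ 1 → h ≠ 1 → ∀ i : Fin (numQubits g),
    IsTrivial g h (pairMove g h (logicalX (pairConfig g h) 0 g i) -
      (logicalX (pairConfig g h) 0 g i +
        ∑ j, (coupling g h i j).val • logicalZ (pairConfig g h) 4 h j)) := by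
  decide +kernel

theorem pairMove_logicalX_second : ∀ g h : Symm, g ≠ 1 → h ≠ 1 → ∀ j : Fin (numQubits h),
    IsTrivial g h (pairMove g h (logicalX (pairConfig g h) 4 h j) -
      (logicalX (pairConfig g h) 4 h j +
        ∑ i, (coupling g h i j).val • logicalZ (pairConfig g h) 0 g i)) := by
  decide +kernel

theorem pairBraid_preservesCode (g h : Symm) : PreservesCode g h pairBraid := by
  refine ⟨pairBraid_config g h, ?_⟩
  change stabilizer g h ≤ (stabilizer g h).comap (pairBraid.moveHom (pairConfig g h))
  refine (AddSubgroup.closure_le _).2 fun a ha => ?_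
  change pairBraid.move (pairConfig g h) a ∈ stabilizer g h
  rw [pairBraid_move]
  have ha' : a ∈ stabilizer g h := AddSubgroup.subset_closure ha
  rcases ha with (⟨i, c, hc, rfl⟩ | ⟨c, rfl⟩) | ⟨c, rfl⟩
  · rwa [pairMove_condensed g h i c hc]
  · rwa [pairMove_loop_first]
  · rwa [pairMove_loop_second]

/-! ### Linear extension from the generators to all logical Pauli operators -/

instance : Module (ZMod 2) Anyon := AddCommGroup.zmodModule fun x => by
  rw [two_nsmul, Anyon.add_self]

theorem val_smul (t : ZMod 2) (a : StringOp) : t.val • a = t • a := by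
  rw [← Nat.cast_smul_eq_nsmul (ZMod 2), ZMod.natCast_val, ZMod.cast_id', id]

theorem logicalPauli_eq_sum (g h : Symm) (v : PauliLabel (numQubits g))
    (w : PauliLabel (numQubits h)) : logicalPauli g h v w =
      ∑ j, (v.1 j • logicalX (pairConfig g h) 0 g j + v.2 j • logicalZ (pairConfig g h) 0 g j) +
      ∑ j, (w.1 j • logicalX (pairConfig g h) 4 h j + w.2 j • logicalZ (pairConfig g h) 4 h j) := by
  simp only [logicalPauli, blockPauli, val_smul]

/-- Since the Z generators are fixed exactly, the deviation from the predicted image is a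
combination of the deviations on X generators, which lie in the stabilizer in the application. -/
theorem map_pauliSum_sub {ι κ M : Type*} [Fintype ι] [Fintype κ] [AddCommGroup M]
    [Module (ZMod 2) M] (μ : M →+ M) (B : Matrix ι κ (ZMod 2)) (X Z : ι → M) (X' Z' : κ → M)
    (hZ : ∀ i, μ (Z i) = Z i) (hZ' : ∀ j, μ (Z' j) = Z' j) (p q : ι → ZMod 2)
    (p' q' : κ → ZMod 2) :
    μ (∑ j, (p j • X j + q j • Z j) + ∑ j, (p' j • X' j + q' j • Z' j)) -
      (∑ j, (p j • X j + (q + B *ᵥ p') j • Z j) +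
        ∑ j, (p' j • X' j + (q' + p ᵥ* B) j • Z' j)) =
      ∑ i, p i • (μ (X i) - (X i + ∑ j, B i j • Z' j)) +
        ∑ j, p' j • (μ (X' j) - (X' j + ∑ i, B i j • Z i)) := by
  have hsmul : ∀ (t : ZMod 2) (a : M), μ (t • a) = t • μ a :=
    (AddMonoidHom.toZModLinearMap 2 μ).map_smul
  have c1 : ∑ j, (p ᵥ* B) j • Z' j = ∑ i, p i • ∑ j, B i j • Z' j := by
    simp only [Matrix.vecMul, dotProduct, Finset.sum_smul, Finset.smul_sum, smul_smul]
    exact Finset.sum_comm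
  have c2 : ∑ i, (B *ᵥ p') i • Z i = ∑ j, p' j • ∑ i, B i j • Z i := by
    simp only [Matrix.mulVec, dotProduct, Finset.sum_smul, Finset.smul_sum, smul_smul, mul_comm]
    exact Finset.sum_comm
  simp only [map_add, map_sum, hsmul, smul_sub, smul_add, Finset.sum_add_distrib,
    Finset.sum_sub_distrib, Pi.add_apply, add_smul, c1, c2, hZ, hZ']
  abel

theorem pairBraid_move_logicalPauli (g h : Symm) (hg : g ≠ 1) (hh : h ≠ 1)
    (v : PauliLabel (numQubits g)) (w : PauliLabel (numQubits h)) :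
    pairBraid.move (pairConfig g h) (logicalPauli g h v w) -
      logicalPauli g h (v.1, v.2 + Matrix.of (coupling g h) *ᵥ w.1)
        (w.1, w.2 + v.1 ᵥ* Matrix.of (coupling g h)) ∈ stabilizer g h := by
  have hmem : ∀ (t : ZMod 2) (a : StringOp), a ∈ stabilizer g h → t • a ∈ stabilizer g h :=
    fun t a ha => by
      rw [← val_smul]; exact nsmul_mem ha _
  rw [← Braid.moveHom_apply, logicalPauli_eq_sum, logicalPauli_eq_sum, map_pauliSum_sub]
  · refine add_mem (sum_mem fun i _ => hmem _ _ ?_) (sum_mem fun i _ => hmem _ _ ?_)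
    · have := (pairMove_logicalX_first g h hg hh i).mem
      simp only [val_smul] at this
      rwa [Braid.moveHom_apply, pairBraid_move]
    · have := (pairMove_logicalX_second g h hg hh i).mem
      simp only [val_smul] at this
      rwa [Braid.moveHom_apply, pairBraid_move]
  · intro i
    rw [Braid.moveHom_apply, pairBraid_move, pairMove_logicalZ_first]
  · intro i
    rw [Braid.moveHom_apply, pairBraid_move, pairMove_logicalZ_second]

theorem pairBraid_implements (g h : Symm) (hg : g ≠ 1) (hh : h ≠ 1) :
    Implements g h pairBraid (phaseGate (Matrix.of (coupling g h))) where
  preserves := pairBraid_preservesCode g h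
  unitary := phaseGate_mem_unitaryGroup _
  conj v w := ⟨_, _, _, by simp, pairBraid_move_logicalPauli g h hg hh v w,
    phaseGate_conj _ v w⟩

/-! ### Cycle types in the symmetry group and numbers of qubits -/

theorem numQubits_eq_two_iff (g : Symm) : numQubits g = 2 ↔ g.IsThreeCycle := by
  rw [← card_support_eq_three_iff]
  revert g
  decide

theorem numQubits_eq_one_of_isSwap {g : Symm} (hg : g.IsSwap) : numQubits g = 1 := by
  obtain ⟨x, y, hxy, rfl⟩ := hg
  revert x y
  decide

theorem isSwap_of_not_isThreeCycle {g : Symm} (h1 : g ≠ 1) (h3 : ¬ g.IsThreeCycle) :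
    g.IsSwap := by
  rw [← numQubits_eq_two_iff] at h3
  unfold Equiv.Perm.IsSwap
  revert g
  decide

/-! ### Gates that commute with all Pauli operators up to phases -/

theorem bits_add_add_cancel {k : ℕ} (x y : Bits k) : x + y + y = x := by
  funext i
  rw [Pi.add_apply, Pi.add_apply, add_assoc, CharTwo.add_self_eq_zero, add_zero]

theorem mul_pauli_apply {k : ℕ} (M : Matrix (Bits k) (Bits k) ℂ) (v : PauliLabel k)
    (x y : Bits k) : (M * pauli v) x y = M x (y + v.1) * (-1) ^ (v.2 ⬝ᵥ y).val := by
  rw [Matrix.mul_apply, Finset.sum_eq_single (y + v.1)]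
  · simp [pauli]
  · intro u _ hu; simp [pauli, hu]
  · simp

theorem pauli_mul_apply {k : ℕ} (M : Matrix (Bits k) (Bits k) ℂ) (v : PauliLabel k)
    (x y : Bits k) : (pauli v * M) x y = (-1) ^ (v.2 ⬝ᵥ (x + v.1)).val * M (x + v.1) y := by
  rw [Matrix.mul_apply, Finset.sum_eq_single (x + v.1)]
  · simp [pauli, bits_add_add_cancel]
  · intro u _ hu
    have : x ≠ u + v.1 := fun h => hu (by rw [h, bits_add_add_cancel])
    simp [pauli, this]
  · simp

theorem conj_eq_of_mul_eq {n : Type*} [Fintype n] [DecidableEq n] {U P Q : Matrix n n ℂ} {z : ℂ}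
    (hU : U ∈ Matrix.unitaryGroup n ℂ) (h : U * P = z • (Q * U)) : U * P * Uᴴ = z • Q := by
  have h1 : U * Uᴴ = 1 := Matrix.mem_unitaryGroup_iff.1 hU
  rw [h, Matrix.smul_mul, mul_assoc, h1, mul_one]

theorem mul_eq_of_conj_eq {n : Type*} [Fintype n] [DecidableEq n] {U P Q : Matrix n n ℂ} {z : ℂ}
    (hU : U ∈ Matrix.unitaryGroup n ℂ) (h : U * P * Uᴴ = z • Q) : U * P = z • (Q * U) := by
  have h1 : Uᴴ * U = 1 := Matrix.mem_unitaryGroup_iff'.1 hU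
  rw [← Matrix.smul_mul, ← h, mul_assoc, h1, mul_one]

/-- The monomial matrix `|y⟩ ↦ χ(y) |y + d⟩`. -/
def shiftPhase {k : ℕ} (d : Bits k) (χ : Bits k → ℂ) : Matrix (Bits k) (Bits k) ℂ :=
  fun x y => if x = y + d then χ y else 0

theorem shiftPhase_mem_unitaryGroup {k : ℕ} (d : Bits k) {χ : Bits k → ℂ}
    (hχ : ∀ y, ‖χ y‖ = 1) : shiftPhase d χ ∈ Matrix.unitaryGroup (Bits k) ℂ := by
  rw [Matrix.mem_unitaryGroup_iff', Matrix.star_eq_conjTranspose]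
  ext x y
  rw [Matrix.mul_apply, Finset.sum_eq_single (y + d)]
  · by_cases h : x = y
    · subst h
      have : (starRingEnd ℂ) (χ x) * χ x = 1 := by
        rw [Complex.conj_mul', hχ]; simp
      simp [shiftPhase, this]
    · have h' : ¬ y = x := fun h' => h h'.symm
      simp [shiftPhase, h, h']
  · intro u _ hu; simp [shiftPhase, hu]
  · simp

/-- The hypothesis `hadd` makes χ a character up to a scalar, so the matrix is a Pauli up to phase
and fixes every Pauli label. -/
theorem shiftPhase_isClifford {k : ℕ} (d : Bits k) {χ : Bits k → ℂ} (hχ : ∀ y, ‖χ y‖ = 1)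
    (hadd : ∀ p, ∃ z, ∀ y, χ (y + p) = z * χ y) : IsClifford (shiftPhase d χ) := by
  refine ⟨shiftPhase_mem_unitaryGroup d hχ, fun v => ?_⟩
  obtain ⟨z, hz⟩ := hadd v.1
  have hz1 : ‖z‖ = 1 := by
    have := congrArg norm (hz 0)
    rwa [norm_mul, hχ, hχ, mul_one, eq_comm] at this
  refine ⟨v, z * (-1) ^ (v.2 ⬝ᵥ d).val, by simp [hz1], ?_⟩
  refine conj_eq_of_mul_eq (shiftPhase_mem_unitaryGroup d hχ) ?_
  ext x y
  rw [mul_pauli_apply, Matrix.smul_apply, pauli_mul_apply, smul_eq_mul]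
  by_cases h : x = y + v.1 + d
  · have h' : x + v.1 = y + d := by rw [h, add_right_comm, bits_add_add_cancel]
    rw [h']
    have e : ((-1 : ℂ) ^ (v.2 ⬝ᵥ d).val) * (-1) ^ (v.2 ⬝ᵥ d).val = 1 := neg_one_pow_val_mul_self _
    simp only [shiftPhase, h, if_true, hz, dotProduct_add, neg_one_pow_val_add]
    linear_combination (-(z * χ y * (-1) ^ (v.2 ⬝ᵥ y).val)) * e
  · have h' : ¬ x + v.1 = y + d := fun h' => h (by
      rw [← bits_add_add_cancel x v.1, h', add_right_comm])
    simp [shiftPhase, h, h']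

theorem IsClifford.mul {k : ℕ} {C D : Matrix (Bits k) (Bits k) ℂ} (hC : IsClifford C)
    (hD : IsClifford D) : IsClifford (C * D) := by
  refine ⟨mul_mem hC.1 hD.1, fun v => ?_⟩
  obtain ⟨v', z, hz, h⟩ := hD.2 v
  obtain ⟨v'', z', hz', h'⟩ := hC.2 v'
  refine ⟨v'', z * z', by simp [hz, hz'], ?_⟩
  rw [Matrix.conjTranspose_mul,
    show C * D * pauli v * (Dᴴ * Cᴴ) = C * (D * pauli v * Dᴴ) * Cᴴ by simp only [mul_assoc],
    h, Matrix.mul_smul, Matrix.smul_mul, h', smul_smul]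

theorem mul_kronecker_pauli_apply {k l : ℕ} (M : Gate k l) (v : PauliLabel k) (w : PauliLabel l)
    (x y : Bits k × Bits l) : (M * (pauli v ⊗ₖ pauli w)) x y =
      M x (y.1 + v.1, y.2 + w.1) * ((-1) ^ (v.2 ⬝ᵥ y.1).val * (-1) ^ (w.2 ⬝ᵥ y.2).val) := by
  rw [Matrix.mul_apply, Finset.sum_eq_single (y.1 + v.1, y.2 + w.1)]
  · simp [pauli, Matrix.kroneckerMap_apply]
  · rintro ⟨u, u'⟩ _ hu
    rw [Ne, Prod.mk.injEq, not_and_or] at hu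
    rcases hu with hu | hu <;> simp [pauli, Matrix.kroneckerMap_apply, hu]
  · simp

theorem kronecker_pauli_mul_apply {k l : ℕ} (M : Gate k l) (v : PauliLabel k) (w : PauliLabel l)
    (x y : Bits k × Bits l) : ((pauli v ⊗ₖ pauli w) * M) x y =
      ((-1) ^ (v.2 ⬝ᵥ (x.1 + v.1)).val * (-1) ^ (w.2 ⬝ᵥ (x.2 + w.1)).val) *
        M (x.1 + v.1, x.2 + w.1) y := by
  rw [Matrix.mul_apply, Finset.sum_eq_single (x.1 + v.1, x.2 + w.1)]
  · simp [pauli, Matrix.kroneckerMap_apply, bits_add_add_cancel]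
  · rintro ⟨u, u'⟩ _ hu
    rw [Ne, Prod.mk.injEq, not_and_or] at hu
    rcases hu with hu | hu
    · have : x.1 ≠ u + v.1 := fun h => hu (by rw [h, bits_add_add_cancel])
      simp [pauli, Matrix.kroneckerMap_apply, this]
    · have : x.2 ≠ u' + w.1 := fun h => hu (by rw [h, bits_add_add_cancel])
      simp [pauli, Matrix.kroneckerMap_apply, this]
  · simp

theorem neg_one_pow_val_injective (a b : ZMod 2) (h : (-1 : ℂ) ^ a.val = (-1) ^ b.val) :
    a = b := by
  have key : ∀ c : ZMod 2, c = 0 ∨ c = 1 := by decide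
  have h1 : ZMod.val (1 : ZMod 2) = 1 := rfl
  rcases key a with rfl | rfl <;> rcases key b with rfl | rfl <;> simp [h1] at h ⊢ <;> norm_num at h

/-- A unitary that fixes every Pauli operator up to a phase is a product of Clifford gates. -/
theorem exists_kronecker_of_conj_pauli {k l : ℕ} {W : Gate k l}
    (hW : W ∈ Matrix.unitaryGroup (Bits k × Bits l) ℂ)
    (h : ∀ v w, ∃ z : ℂ, ‖z‖ = 1 ∧
      W * (pauli v ⊗ₖ pauli w) * Wᴴ = z • (pauli v ⊗ₖ pauli w)) :
    ∃ A B, IsClifford A ∧ IsClifford B ∧ W = A ⊗ₖ B := by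
  have hcomm : ∀ (v : PauliLabel k) (w : PauliLabel l), ∃ z : ℂ, ‖z‖ = 1 ∧
      ∀ x y, W x (y.1 + v.1, y.2 + w.1) *
        ((-1) ^ (v.2 ⬝ᵥ y.1).val * (-1) ^ (w.2 ⬝ᵥ y.2).val) =
        z * (((-1) ^ (v.2 ⬝ᵥ (x.1 + v.1)).val * (-1) ^ (w.2 ⬝ᵥ (x.2 + w.1)).val) *
        W (x.1 + v.1, x.2 + w.1) y) := fun v w => by
    obtain ⟨z, hz, e⟩ := h v w
    refine ⟨z, hz, fun x y => ?_⟩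
    have := congrFun (congrFun (mul_eq_of_conj_eq hW e) x) y
    rwa [mul_kronecker_pauli_apply, Matrix.smul_apply, kronecker_pauli_mul_apply,
      smul_eq_mul] at this
  have hW1 : star W * W = 1 := Matrix.mem_unitaryGroup_iff'.1 hW
  obtain ⟨x₀, hx₀⟩ : ∃ x₀, W x₀ 0 ≠ 0 := by
    by_contra! H
    have := congrFun (congrFun hW1 0) 0
    rw [Matrix.mul_apply] at this
    simp [H] at this
  -- Z-type Paulis only contribute signs. Comparing a nonzero entry with the one at `(x₀, 0)`
  -- eliminates the unknown phase, and unit vectors `q`, `q'` then read off each coordinate.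
  have hsupp : ∀ x y, W x y ≠ 0 → x = (y.1 + x₀.1, y.2 + x₀.2) := by
    intro x y hxy
    have key : ∀ q q', (q ⬝ᵥ y.1 + q' ⬝ᵥ y.2) = (q ⬝ᵥ x₀.1 + q' ⬝ᵥ x₀.2) +
        (q ⬝ᵥ x.1 + q' ⬝ᵥ x.2) := by
      intro q q'
      obtain ⟨z, hz, e⟩ := hcomm (0, q) (0, q')
      have e1 := e x y
      have e2 := e x₀ 0
      simp only [add_zero, Prod.mk.eta, Prod.fst_zero, Prod.snd_zero, dotProduct_zero,
        ← neg_one_pow_val_add] at e1 e2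
      have e1' : (-1 : ℂ) ^ (q ⬝ᵥ y.1 + q' ⬝ᵥ y.2).val =
          z * (-1) ^ (q ⬝ᵥ x.1 + q' ⬝ᵥ x.2).val :=
        mul_left_cancel₀ hxy (by rw [e1]; ring)
      have e2' : (1 : ℂ) = z * (-1) ^ (q ⬝ᵥ x₀.1 + q' ⬝ᵥ x₀.2).val :=
        mul_left_cancel₀ hx₀ (by simpa [Prod.mk_zero_zero, mul_comm, mul_left_comm, mul_assoc] using e2)
      apply neg_one_pow_val_injective
      rw [neg_one_pow_val_add (q ⬝ᵥ x₀.1 + q' ⬝ᵥ x₀.2), e1']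
      have e3 : ((-1 : ℂ) ^ (q ⬝ᵥ x₀.1 + q' ⬝ᵥ x₀.2).val) *
        (-1) ^ (q ⬝ᵥ x₀.1 + q' ⬝ᵥ x₀.2).val = 1 := neg_one_pow_val_mul_self _
      linear_combination (-((-1 : ℂ) ^ (q ⬝ᵥ x.1 + q' ⬝ᵥ x.2).val) *
        (-1) ^ (q ⬝ᵥ x₀.1 + q' ⬝ᵥ x₀.2).val) * e2' -
        z * (-1) ^ (q ⬝ᵥ x.1 + q' ⬝ᵥ x.2).val * e3
    have hc : ∀ a b c : ZMod 2, a = b + c → c = a + b := by decide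
    refine Prod.ext (funext fun i => ?_) (funext fun i => ?_)
    · have := key (Pi.single i 1) 0
      simp only [single_one_dotProduct, zero_dotProduct, add_zero] at this
      exact hc _ _ _ this
    · have := key 0 (Pi.single i 1)
      simp only [single_one_dotProduct, zero_dotProduct, zero_add] at this
      exact hc _ _ _ this
  set f : Bits k → Bits l → ℂ := fun y y' => W (y + x₀.1, y' + x₀.2) (y, y') with hf
  have hWf : ∀ x y, W x y = if x = (y.1 + x₀.1, y.2 + x₀.2) then f y.1 y.2 else 0 := by
    intro x y
    split_ifs with hxy
    · rw [hxy]
    · by_contra hne; exact hxy (hsupp x y hne)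
  -- X-type Paulis translate row and column together, so translation multiplies the surviving
  -- entries by a constant; this makes `f` split as a product.
  have hadd : ∀ p p', ∃ z : ℂ, ‖z‖ = 1 ∧ ∀ y y', f (y + p) (y' + p') = z * f y y' := by
    intro p p'
    obtain ⟨z, hz, e⟩ := hcomm (p, 0) (p', 0)
    refine ⟨z, hz, fun y y' => ?_⟩
    have := e (y + p + x₀.1, y' + p' + x₀.2) (y, y')
    simp only [zero_dotProduct, ZMod.val_zero, pow_zero, mul_one, one_mul] at this
    simp only [hf]
    rw [this, add_right_comm, bits_add_add_cancel, add_right_comm y', bits_add_add_cancel]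
  have hf0 : ‖f 0 0‖ = 1 := by
    have := congrFun (congrFun hW1 0) 0
    rw [Matrix.mul_apply, Finset.sum_eq_single x₀] at this
    · have e : W x₀ 0 = f 0 0 := by simp [hf, Prod.mk_zero_zero]
      rw [Matrix.star_apply, e, Matrix.one_apply_eq, ← starRingEnd_apply, Complex.conj_mul'] at this
      have h2 : ‖f 0 0‖ ^ 2 = 1 := by exact_mod_cast this
      exact (pow_eq_one_iff_of_nonneg (norm_nonneg _) two_ne_zero).1 h2
    · intro x _ hx
      have : W x 0 = 0 := by
        rw [hWf, if_neg]; simpa using hx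
      simp [this]
    · simp
  have hne : f 0 0 ≠ 0 := fun h0 => by simp [h0] at hf0
  have hnorm : ∀ y y', ‖f y y'‖ = 1 := fun y y' => by
    obtain ⟨z, hz, e⟩ := hadd y y'
    have := e 0 0
    rw [zero_add, zero_add] at this
    rw [this, norm_mul, hz, hf0, one_mul]
  refine ⟨shiftPhase x₀.1 fun y => f y 0, shiftPhase x₀.2 fun y' => f 0 y' / f 0 0,
    shiftPhase_isClifford _ (fun y => hnorm y 0) fun p => ?_,
    shiftPhase_isClifford _ (fun y => by rw [norm_div, hnorm, hf0, div_one]) fun p => ?_, ?_⟩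
  · obtain ⟨z, hz, e⟩ := hadd p 0
    exact ⟨z, fun y => by simpa using e y 0⟩
  · obtain ⟨z, hz, e⟩ := hadd 0 p
    exact ⟨z, fun y => by rw [← mul_div_assoc, ← e 0 y, zero_add]⟩
  · ext ⟨x, x'⟩ ⟨y, y'⟩
    rw [hWf, Matrix.kroneckerMap_apply]
    have hsplit : f y y' = f y 0 * (f 0 y' / f 0 0) := by
      obtain ⟨z, -, e⟩ := hadd y 0
      have e1 := e 0 y'
      have e2 := e 0 0
      rw [zero_add, add_zero] at e1 e2
      rw [e1, e2]
      field_simp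
    by_cases h1 : x = y + x₀.1 <;> by_cases h2 : x' = y' + x₀.2 <;>
      simp [shiftPhase, h1, h2, hsplit]

/-! ### Permuting the four twists of an encoding by a 2-cycle -/

section Conjugation

variable {k : ℕ}

/-- A unitary that conjugates the Pauli operators, up to phases, as `L` prescribes. -/
def Conjugates (C : Matrix (Bits k) (Bits k) ℂ) (L : PauliLabel k → PauliLabel k) : Prop :=
  C ∈ Matrix.unitaryGroup (Bits k) ℂ ∧
    ∀ v, ∃ z : ℂ, ‖z‖ = 1 ∧ C * pauli v * Cᴴ = z • pauli (L v)

theorem Conjugates.isClifford {C : Matrix (Bits k) (Bits k) ℂ} {L : PauliLabel k → PauliLabel k}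
    (h : Conjugates C L) : IsClifford C := ⟨h.1, fun v => ⟨L v, h.2 v⟩⟩

theorem Conjugates.mul {C D : Matrix (Bits k) (Bits k) ℂ} {L M : PauliLabel k → PauliLabel k}
    (hC : Conjugates C L) (hD : Conjugates D M) : Conjugates (C * D) (L ∘ M) := by
  refine ⟨mul_mem hC.1 hD.1, fun v => ?_⟩
  obtain ⟨z, hz, h⟩ := hD.2 v
  obtain ⟨z', hz', h'⟩ := hC.2 (M v)
  refine ⟨z * z', by simp [hz, hz'], ?_⟩
  rw [Matrix.conjTranspose_mul,
    show C * D * pauli v * (Dᴴ * Cᴴ) = C * (D * pauli v * Dᴴ) * Cᴴ by simp only [mul_assoc],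
    h, Matrix.mul_smul, Matrix.smul_mul, h', smul_smul, Function.comp_apply]

theorem conjugates_one : Conjugates (1 : Matrix (Bits k) (Bits k) ℂ) id :=
  ⟨one_mem _, fun v => ⟨1, by simp, by simp⟩⟩

/-- The Pauli label of a set of encircled twists. -/
def vecLabel (u : Fin 4 → ZMod 2) : PauliLabel k := (fun _ => u 2 + u 3, fun _ => u 1 + u 3)

theorem vecLabel_add_const (u : Fin 4 → ZMod 2) (c : ZMod 2) :
    (vecLabel (fun i => u i + c) : PauliLabel k) = vecLabel u := by
  have h := CharTwo.add_self_eq_zero c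
  refine Prod.ext (funext fun i => ?_) (funext fun i => ?_) <;>
  simp only [vecLabel] <;> linear_combination h

end Conjugation

section Block

variable {k : ℕ} [Unique (Fin k)]

/-- Which of the four twists of an encoding by a 2-cycle are encircled, for a Pauli label. -/
def labelVec (v : PauliLabel k) : Fin 4 → ZMod 2 :=
  ![v.1 default + v.2 default, v.2 default, v.1 default, 0]

/-- Representatives are normalised to vanish at the last twist, at the cost of a loop around all
four; even weight recovers the coordinate 0, which the label does not store. -/
theorem labelVec_vecLabel (u : Fin 4 → ZMod 2) (hu : ∑ i, u i = 0) (i : Fin 4) :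
    labelVec (vecLabel u : PauliLabel k) i = u i + u 3 := by
  rw [Fin.sum_univ_four] at hu
  have h3 := CharTwo.add_self_eq_zero (u 3)
  have h0 := CharTwo.add_self_eq_zero (u 0)
  fin_cases i
  · simp [labelVec, vecLabel]
    linear_combination hu - h0
  · simp [labelVec, vecLabel]
  · simp [labelVec, vecLabel]
  · simp [labelVec, h3]

theorem vecLabel_labelVec (v : PauliLabel k) : vecLabel (labelVec v) = v := by
  refine Prod.ext (funext fun i => ?_) (funext fun i => ?_) <;>
  simp [vecLabel, labelVec, Unique.eq_default i]

theorem sum_labelVec (v : PauliLabel k) : ∑ i, labelVec v i = 0 := by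
  rw [Fin.sum_univ_four]
  simp only [labelVec, Matrix.cons_val]
  linear_combination CharTwo.add_self_eq_zero (v.1 default) +
    CharTwo.add_self_eq_zero (v.2 default)

theorem eq_of_labelVec_eq_add_const {v v' : PauliLabel k} {c : ZMod 2}
    (h : ∀ i, labelVec v i = labelVec v' i + c) : v = v' := by
  rw [← vecLabel_labelVec v, funext h, vecLabel_add_const, vecLabel_labelVec]

/-- The action of a permutation of the twists on the Pauli labels. -/
def permLabel (σ : Equiv.Perm (Fin 4)) (v : PauliLabel k) : PauliLabel k :=
  vecLabel fun i => labelVec v (σ⁻¹ i)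

theorem labelVec_permLabel (σ : Equiv.Perm (Fin 4)) (v : PauliLabel k) (i : Fin 4) :
    labelVec (permLabel σ v) i = labelVec v (σ⁻¹ i) + labelVec v (σ⁻¹ 3) :=
  labelVec_vecLabel _ ((Equiv.sum_comp σ⁻¹ (labelVec v)).trans (sum_labelVec v)) i

theorem permLabel_one (v : PauliLabel k) : permLabel 1 v = v := vecLabel_labelVec v

theorem permLabel_mul (σ τ : Equiv.Perm (Fin 4)) (v : PauliLabel k) :
    permLabel (σ * τ) v = permLabel σ (permLabel τ v) := by
  rw [permLabel, permLabel]
  simp only [labelVec_permLabel, vecLabel_add_const, mul_inv_rev, Equiv.Perm.mul_apply]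

/-- The phase gate `|y⟩ ↦ i^y |y⟩`. -/
def gateS : Matrix (Bits k) (Bits k) ℂ := shiftPhase 0 fun y => Complex.I ^ (y default).val

theorem conjugates_gateS :
    Conjugates (gateS : Matrix (Bits k) (Bits k) ℂ) fun v => (v.1, v.1 + v.2) := by
  have hU : (gateS : Matrix (Bits k) (Bits k) ℂ) ∈ Matrix.unitaryGroup (Bits k) ℂ :=
    shiftPhase_mem_unitaryGroup 0 fun y => by simp
  refine ⟨hU, fun v => ⟨Complex.I ^ (v.1 default).val * 1, by simp, conj_eq_of_mul_eq hU ?_⟩⟩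
  -- The sum is reduced modulo 2, and the lost carry gives the sign `(-1)^(p * y)`: this is the Z
  -- that the phase gate attaches to X.
  have key : ∀ p y : ZMod 2, Complex.I ^ (y + p).val =
      Complex.I ^ p.val * ((-1) ^ (p * y).val * Complex.I ^ y.val) := by
    intro p y
    have hz : ∀ t : ZMod 2, t = 0 ∨ t = 1 := by decide
    have h1 : ZMod.val (1 : ZMod 2) = 1 := rfl
    have h2 : (1 : ZMod 2) + 1 = 0 := rfl
    rcases hz p with rfl | rfl <;> rcases hz y with rfl | rfl <;> simp [h1, h2]
  ext x y
  rw [mul_pauli_apply, Matrix.smul_apply, pauli_mul_apply, smul_eq_mul]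
  by_cases h : x = y + v.1
  · subst h
    have hdot : v.1 ⬝ᵥ y = v.1 default * y default := by simp [dotProduct]
    simp only [gateS, shiftPhase, bits_add_add_cancel, add_zero, if_true, Pi.add_apply, key,
      add_dotProduct, neg_one_pow_val_add, hdot]
    ring
  · have h' : ¬ x + v.1 = y := fun h' => h (by rw [← h', bits_add_add_cancel])
    simp [gateS, shiftPhase, h, h']

/-- The Hadamard gate. -/
def gateH : Matrix (Bits k) (Bits k) ℂ :=
  fun x y => ((Real.sqrt 2 : ℝ) : ℂ)⁻¹ * (-1) ^ (x ⬝ᵥ y).val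

theorem gateH_mem_unitaryGroup :
    (gateH : Matrix (Bits k) (Bits k) ℂ) ∈ Matrix.unitaryGroup (Bits k) ℂ := by
  rw [Matrix.mem_unitaryGroup_iff, Matrix.star_eq_conjTranspose]
  ext x y
  have h2 : ((Real.sqrt 2 : ℝ) : ℂ)⁻¹ * ((Real.sqrt 2 : ℝ) : ℂ)⁻¹ = 2⁻¹ := by
    rw [← mul_inv, ← Complex.ofReal_mul, Real.mul_self_sqrt zero_le_two]; norm_num
  have e : ∀ u : Bits k, gateH x u * gateHᴴ u y =
      2⁻¹ * (-1) ^ ((x default + y default) * u default).val := fun u => by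
    rw [add_mul, neg_one_pow_val_add, ← h2]
    simp [gateH, dotProduct]
    ring
  rw [Matrix.mul_apply, Finset.sum_congr rfl fun u _ => e u,
    ← Equiv.sum_comp (Equiv.funUnique (Fin k) (ZMod 2)).symm]
  have key : ∀ s : ZMod 2, ∑ t : ZMod 2, (2⁻¹ : ℂ) * (-1) ^ (s * t).val =
      if s = 0 then 1 else 0 := by
    intro s
    have hs : s = 0 ∨ s = 1 := by revert s; decide
    have h1 : ZMod.val (1 : ZMod 2) = 1 := rfl
    have huniv : (Finset.univ : Finset (ZMod 2)) = {0, 1} := by decide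
    rw [huniv, Finset.sum_pair (by decide)]
    rcases hs with rfl | rfl
    · norm_num
    · simp [h1]
  refine (key (x default + y default)).trans ?_
  rw [Matrix.one_apply]
  refine if_congr ?_ rfl rfl
  rw [CharTwo.add_eq_zero]
  constructor
  · intro h; funext i; rw [Unique.eq_default i, h]
  · rintro rfl; rfl

theorem conjugates_gateH :
    Conjugates (gateH : Matrix (Bits k) (Bits k) ℂ) fun v => (v.2, v.1) := by
  refine ⟨gateH_mem_unitaryGroup, fun v => ⟨(-1) ^ (v.1 ⬝ᵥ v.2).val, by simp,
    conj_eq_of_mul_eq gateH_mem_unitaryGroup ?_⟩⟩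
  ext x y
  rw [mul_pauli_apply, Matrix.smul_apply, pauli_mul_apply, smul_eq_mul]
  have e : ((-1 : ℂ) ^ (v.1 ⬝ᵥ v.2).val) * (-1) ^ (v.1 ⬝ᵥ v.2).val = 1 :=
    neg_one_pow_val_mul_self _
  simp only [gateH, dotProduct_add, add_dotProduct, neg_one_pow_val_add, dotProduct_comm x v.1]
  linear_combination (-(((Real.sqrt 2 : ℝ) : ℂ)⁻¹ * (-1) ^ (x ⬝ᵥ y).val * (-1) ^ (v.1 ⬝ᵥ x).val *
    (-1) ^ (v.2 ⬝ᵥ y).val)) * e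

/-- Adjacent transpositions generate the group. The middle one interchanges X and Z (Hadamard); both
outer ones fix Z and send X to XZ (phase gate). -/
theorem exists_conjugates_permLabel (σ : Equiv.Perm (Fin 4)) :
    ∃ C : Matrix (Bits k) (Bits k) ℂ, Conjugates C (permLabel σ) := by
  have hσ : σ ∈ Submonoid.closure
      (Set.range fun i : Fin 3 => Equiv.swap i.castSucc i.succ) := by
    rw [Equiv.Perm.mclosure_swap_castSucc_succ]; trivial
  induction hσ using Submonoid.closure_induction with
  | mem τ hτ =>
    obtain ⟨i, rfl⟩ := hτ
    have hS : ∀ τ : Equiv.Perm (Fin 4), (∀ v : PauliLabel k, permLabel τ v = (v.1, v.1 + v.2)) →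
        ∃ C : Matrix (Bits k) (Bits k) ℂ, Conjugates C (permLabel τ) := fun τ h =>
      ⟨gateS, by rw [funext h]; exact conjugates_gateS⟩
    have hH : ∀ τ : Equiv.Perm (Fin 4), (∀ v : PauliLabel k, permLabel τ v = (v.2, v.1)) →
        ∃ C : Matrix (Bits k) (Bits k) ℂ, Conjugates C (permLabel τ) := fun τ h =>
      ⟨gateH, by rw [funext h]; exact conjugates_gateH⟩
    fin_cases i
    · refine hS _ fun v => Prod.ext (funext fun i => ?_) (funext fun i => ?_)
      · change labelVec v 2 + labelVec v 3 = _
        simp [labelVec, Unique.eq_default i]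
      · change labelVec v 0 + labelVec v 3 = _
        simp [labelVec, Unique.eq_default i]
    · refine hH _ fun v => Prod.ext (funext fun i => ?_) (funext fun i => ?_)
      · change labelVec v 1 + labelVec v 3 = _
        simp [labelVec, Unique.eq_default i]
      · change labelVec v 2 + labelVec v 3 = _
        simp [labelVec, Unique.eq_default i]
    · refine hS _ fun v => Prod.ext (funext fun i => ?_) (funext fun i => ?_)
      · change labelVec v 3 + labelVec v 2 = _
        simp [labelVec, Unique.eq_default i]
      · change labelVec v 1 + labelVec v 2 = _
        simp [labelVec, Unique.eq_default i, add_comm]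
  | one => exact ⟨1, by rw [funext permLabel_one]; exact conjugates_one⟩
  | mul σ τ _ _ ihσ ihτ =>
    obtain ⟨C, hC⟩ := ihσ
    obtain ⟨D, hD⟩ := ihτ
    exact ⟨C * D, by rw [funext (permLabel_mul σ τ)]; exact hC.mul hD⟩

end Block

/-! ### Charges modulo those condensed by a 2-cycle -/

/-- Whether a charge is moved by `g`. For a 2-cycle this is the charge modulo condensed ones. -/
def Anyon.moved (g : Symm) (x : Anyon) : ZMod 2 := if Anyon.act g x = x then 0 else 1

/-- If exactly one fermion is fixed, the condensed charges have index two and this is the quotient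
map. For a 3-cycle additivity fails: two moved fermions can fuse to a moved one. -/
theorem Anyon.moved_add : ∀ g : Symm, numQubits g = 1 → ∀ x y : Anyon,
    Anyon.moved g (x + y) = Anyon.moved g x + Anyon.moved g y := by
  decide +kernel

theorem Anyon.moved_act : ∀ (g : Symm) (x : Anyon),
    Anyon.moved g (Anyon.act g x) = Anyon.moved g x := by
  decide +kernel

theorem Anyon.act_eq_self_of_moved_eq_zero {g : Symm} {x : Anyon} (h : Anyon.moved g x = 0) :
    Anyon.act g x = x := by
  by_contra hne
  simp [Anyon.moved, hne] at h

theorem Anyon.moved_zero (g : Symm) : Anyon.moved g 0 = 0 := by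
  simp [Anyon.moved, Anyon.act_zero]

theorem Anyon.moved_zCharge : ∀ g : Symm, g ≠ 1 → numQubits g = 1 → ∀ j : ℕ,
    Anyon.moved g (zCharge g j) = 1 := by
  intro g hg h j
  have hc : ∃ c, g c = c := by
    by_contra hc
    simp [numQubits, hc] at h
  rw [zCharge, if_pos hc]
  revert g
  decide

theorem Anyon.moved_xCharge (g : Symm) (hg : g ≠ 1) (h : numQubits g = 1) (j : ℕ) :
    Anyon.moved g (xCharge g j) = 1 := by
  have hc : ∃ c, g c = c := by
    by_contra hc
    simp [numQubits, hc] at h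
  rw [xCharge, if_pos hc, Anyon.moved_zCharge g hg h]

section TwoCycle

variable {g : Symm} (hs : g.IsSwap)

/-- A string operator modulo condensed charges. -/
def reduce (hs : g.IsSwap) : StringOp →+ (Fin 8 → ZMod 2) :=
  AddMonoidHom.mk' (fun a i => Anyon.moved g (a i)) fun a b => funext fun i =>
    Anyon.moved_add g (numQubits_eq_one_of_isSwap hs) (a i) (b i)

theorem reduce_apply (a : StringOp) (i : Fin 8) : reduce hs a i = Anyon.moved g (a i) := rfl

theorem inv_eq_self_of_isSwap {g : Symm} (hs : g.IsSwap) : g⁻¹ = g := by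
  obtain ⟨x, y, -, rfl⟩ := hs
  exact Equiv.swap_inv x y

theorem ne_one_of_isSwap {g : Symm} (hs : g.IsSwap) : g ≠ 1 := by
  rintro rfl
  obtain ⟨x, y, hxy, h⟩ := hs
  exact hxy (by simpa using congrArg (fun σ : Symm => σ y) h.symm)

theorem pairConfig_self {g : Symm} (hs : g.IsSwap) : pairConfig g g = fun _ => g := by
  funext i
  fin_cases i <;> simp [pairConfig, inv_eq_self_of_isSwap hs]

theorem letter_const_fst (x : Fin 7 × Bool) (a : StringOp) :
    (letter x (fun _ => g, a)).1 = fun _ => g := by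
  obtain ⟨i, _ | _⟩ := x <;> funext j <;>
  simp [letter, exchange, exchangeInv]

/-- Besides moving the charges, an exchange only adds terms of the form b + gb, which are condensed.
-/
theorem reduce_letter (x : Fin 7 × Bool) (a : StringOp) (j : Fin 8) :
    reduce hs (letter x (fun _ => g, a)).2 (Equiv.swap (x.1.castSucc : Fin 8) x.1.succ j) =
      reduce hs a j := by
  obtain ⟨i, b⟩ := x
  have hne : (i.castSucc : Fin 8) ≠ i.succ := Fin.castSucc_lt_succ.ne
  have hadd := Anyon.moved_add g (numQubits_eq_one_of_isSwap hs)
  have hinv := inv_eq_self_of_isSwap hs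
  have hmul : ∀ x, Anyon.moved g (Anyon.act (g * g) x) = Anyon.moved g x := fun x => by
    rw [← Anyon.act_act, Anyon.moved_act, Anyon.moved_act]
  have h2 : ∀ t : ZMod 2, t + t = 0 := CharTwo.add_self_eq_zero
  by_cases hp : j = i.castSucc
  · subst hp
    rw [Equiv.swap_apply_left]
    cases b <;> simp [letter, exchange, exchangeInv, reduce_apply, hinv, hadd, Anyon.moved_act,
      add_assoc, h2]
  · by_cases hq : j = i.succ
    · subst hq
      rw [Equiv.swap_apply_right]
      cases b <;> simp [letter, exchange, exchangeInv, reduce_apply, hinv, hadd, Anyon.moved_act,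
        hmul, add_assoc, h2, hne]
    · rw [Equiv.swap_apply_of_ne_of_ne hp hq]
      cases b <;> simp [letter, exchange, exchangeInv, reduce_apply, hp, hq]

theorem reduce_move (β : Braid) (a : StringOp) (j : Fin 8) :
    reduce hs (β.move (fun _ => g) a) (β.perm j) = reduce hs a j := by
  induction β generalizing a j with
  | nil => rfl
  | cons x β ih =>
    have e : letter x (fun _ => g, a) = (fun _ => g, (letter x (fun _ => g, a)).2) :=
      Prod.ext (letter_const_fst x a) rfl
    have e' : Braid.move (x :: β) (fun _ => g) a =
        Braid.move β (fun _ => g) (letter x (fun _ => g, a)).2 := by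
      rw [Braid.move, Braid.apply_cons, e]
      rfl
    rw [e', ← reduce_letter hs x a j, ← ih (letter x (fun _ => g, a)).2]
    rfl

/-- The position of the `i`-th twist of the first encoding. -/
def firstPos (i : Fin 4) : Fin 8 := Fin.castAdd 4 i

/-- The position of the `i`-th twist of the second encoding. -/
def secondPos (i : Fin 4) : Fin 8 := Fin.natAdd 4 i

theorem reduce_loop_first (c : Anyon) :
    (∀ i, reduce hs (loop (fun _ => g) [3, 2, 1, 0] c) (firstPos i) = Anyon.moved g c) ∧
      ∀ i, reduce hs (loop (fun _ => g) [3, 2, 1, 0] c) (secondPos i) = 0 := by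
  constructor <;> intro i <;> fin_cases i <;>
  simp [reduce_apply, firstPos, secondPos, loop, Fin.ext_iff, Anyon.moved_act,
    Anyon.moved_zero]

theorem reduce_loop_second (c : Anyon) :
    (∀ i, reduce hs (loop (fun _ => g) [7, 6, 5, 4] c) (firstPos i) = 0) ∧
      ∀ i, reduce hs (loop (fun _ => g) [7, 6, 5, 4] c) (secondPos i) = Anyon.moved g c := by
  constructor <;> intro i <;> fin_cases i <;>
  simp [reduce_apply, firstPos, secondPos, loop, Fin.ext_iff, Anyon.moved_act,
    Anyon.moved_zero]

theorem firstPos_or_secondPos (j : Fin 8) : (∃ i, j = firstPos i) ∨ ∃ i, j = secondPos i := by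
  revert j
  decide

/-- The operators acting trivially are those that are constant on each encoding modulo condensed
charges. -/
theorem mem_stabilizer_iff (a : StringOp) : a ∈ stabilizer g g ↔
    ∃ s t, (∀ i, reduce hs a (firstPos i) = s) ∧ ∀ i, reduce hs a (secondPos i) = t := by
  constructor
  · intro ha
    induction ha using AddSubgroup.closure_induction with
    | mem a ha =>
      rw [pairConfig_self hs] at ha
      rcases ha with (⟨i, c, hc, rfl⟩ | ⟨c, rfl⟩) | ⟨c, rfl⟩
      · have hm : ∀ j, reduce hs (Pi.single i c) j = 0 := fun j => by
          rw [reduce_apply, Pi.single_apply]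
          split_ifs
          · exact if_pos hc
          · exact Anyon.moved_zero g
        exact ⟨0, 0, fun _ => hm _, fun _ => hm _⟩
      · exact ⟨_, _, reduce_loop_first hs c⟩
      · exact ⟨_, _, reduce_loop_second hs c⟩
    | zero => exact ⟨0, 0, fun i => by simp, fun i => by simp⟩
    | add a b _ _ iha ihb =>
      obtain ⟨s, t, h1, h2⟩ := iha
      obtain ⟨s', t', h1', h2'⟩ := ihb
      exact ⟨s + s', t + t', fun i => by simp [h1, h1'], fun i => by simp [h2, h2']⟩
    | neg a _ iha =>
      obtain ⟨s, t, h1, h2⟩ := iha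
      exact ⟨-s, -t, fun i => by simp [h1], fun i => by simp [h2]⟩
  · rintro ⟨s, t, h1, h2⟩
    -- The charges at twists 3 and 7 supply the block loops, which have the right constant values
    -- `s` and `t`.
    refine IsTrivial.mem fun i => ?_
    rw [pairConfig_self hs]
    apply Anyon.act_eq_self_of_moved_eq_zero
    rw [← reduce_apply hs, map_sub, map_sub, Pi.sub_apply, Pi.sub_apply]
    have e3 : Anyon.moved g (a 3) = s := h1 3
    have e7 : Anyon.moved g (a 7) = t := h2 3
    rcases firstPos_or_secondPos i with ⟨i, rfl⟩ | ⟨i, rfl⟩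
    · rw [h1, (reduce_loop_first hs _).1, (reduce_loop_second hs _).1, e3, sub_self, sub_zero]
    · rw [h2, (reduce_loop_first hs _).2, (reduce_loop_second hs _).2, e7, sub_zero, sub_self]

theorem reduce_logicalPauli [Unique (Fin (numQubits g))] (v w : PauliLabel (numQubits g)) :
    (∀ i, reduce hs (logicalPauli g g v w) (firstPos i) = labelVec v i) ∧
      ∀ i, reduce hs (logicalPauli g g v w) (secondPos i) = labelVec w i := by
  have hg : g ≠ 1 := ne_one_of_isSwap hs
  have hn := numQubits_eq_one_of_isSwap hs
  have hx := Anyon.moved_xCharge g hg hn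
  have hz := Anyon.moved_zCharge g hg hn
  have hadd := Anyon.moved_add g hn
  have hsmul : ∀ (n : ℕ) (x : Anyon), Anyon.moved g (n • x) = n * Anyon.moved g x := fun n x => by
    rw [← nsmul_eq_mul]
    exact map_nsmul (AddMonoidHom.mk' (Anyon.moved g) hadd) n x
  have h5 : ((4 : Fin 8) + 1) = 5 := rfl
  have h6 : ((4 : Fin 8) + 2) = 6 := rfl
  have key : ∀ i, reduce hs (logicalPauli g g v w) i =
      (![v.1 default + v.2 default, v.2 default, v.1 default, 0,
        w.1 default + w.2 default, w.2 default, w.1 default, 0] : Fin 8 → ZMod 2) i := by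
    intro i
    simp only [logicalPauli, blockPauli, Fintype.sum_unique, logicalX, logicalZ,
      pairConfig_self hs, Pi.add_apply, Pi.smul_apply, reduce_apply]
    fin_cases i <;>
    simp [loop, h5, h6, Fin.ext_iff, hadd, hsmul, Anyon.moved_act, Anyon.moved_zero, hx, hz]
  constructor <;> intro i <;> rw [key] <;> fin_cases i <;> rfl

end TwoCycle

/-! ### Product gates and the exchange of the encodings -/

theorem gateSwap_mul_apply {k : ℕ} (M : Gate k k) (x y : Bits k × Bits k) :
    (gateSwap k * M) x y = M x.swap y := by
  rw [Matrix.mul_apply, Finset.sum_eq_single x.swap]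
  · simp [gateSwap]
  · rintro ⟨u, u'⟩ _ hu
    have : ¬ (x.1 = u' ∧ x.2 = u) := fun h => hu (Prod.ext h.2.symm h.1.symm)
    simp [gateSwap, this]
  · simp

theorem mul_gateSwap_apply {k : ℕ} (M : Gate k k) (x y : Bits k × Bits k) :
    (M * gateSwap k) x y = M x y.swap := by
  rw [Matrix.mul_apply, Finset.sum_eq_single y.swap]
  · simp [gateSwap]
  · rintro ⟨u, u'⟩ _ hu
    have : ¬ (u = y.2 ∧ u' = y.1) := fun h => hu (Prod.ext h.1 h.2)
    simp [gateSwap, this]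
  · simp

theorem gateSwap_mul_kronecker {k : ℕ} (A B : Matrix (Bits k) (Bits k) ℂ) :
    gateSwap k * (A ⊗ₖ B) = (B ⊗ₖ A) * gateSwap k := by
  ext x y
  rw [gateSwap_mul_apply, mul_gateSwap_apply]
  simp [Matrix.kroneckerMap_apply, mul_comm]

theorem gateSwap_mul_self (k : ℕ) : gateSwap k * gateSwap k = 1 := by
  ext x y
  rw [gateSwap_mul_apply, Matrix.one_apply]
  simp only [gateSwap, Prod.fst_swap, Prod.snd_swap]
  exact if_congr ⟨fun h => Prod.ext h.2 h.1, fun h => by rw [h]; exact ⟨rfl, rfl⟩⟩ rfl rfl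

theorem gateSwap_conjTranspose (k : ℕ) : (gateSwap k)ᴴ = gateSwap k := by
  ext x y
  have e : (y.1 = x.2 ∧ y.2 = x.1) ↔ (x.1 = y.2 ∧ x.2 = y.1) :=
    ⟨fun h => ⟨h.2.symm, h.1.symm⟩, fun h => ⟨h.2.symm, h.1.symm⟩⟩
  simp only [gateSwap, Matrix.conjTranspose_apply, e]
  split_ifs <;> simp

theorem gateSwap_mem_unitaryGroup (k : ℕ) :
    gateSwap k ∈ Matrix.unitaryGroup (Bits k × Bits k) ℂ := by
  rw [Matrix.mem_unitaryGroup_iff, Matrix.star_eq_conjTranspose, gateSwap_conjTranspose,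
    gateSwap_mul_self]

theorem kronecker_conj {k l : ℕ} (A P : Matrix (Bits k) (Bits k) ℂ)
    (B Q : Matrix (Bits l) (Bits l) ℂ) :
    (A ⊗ₖ B) * (P ⊗ₖ Q) * (A ⊗ₖ B)ᴴ = (A * P * Aᴴ) ⊗ₖ (B * Q * Bᴴ) := by
  rw [Matrix.conjTranspose_kronecker, ← Matrix.mul_kronecker_mul, ← Matrix.mul_kronecker_mul]

theorem not_isEntangling_kronecker {k l : ℕ} (A : Matrix (Bits k) (Bits k) ℂ)
    (B : Matrix (Bits l) (Bits l) ℂ) : ¬ IsEntangling (A ⊗ₖ B) := by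
  rintro ⟨ψ, φ, h⟩
  refine h (A *ᵥ ψ) (B *ᵥ φ) (funext fun x => ?_)
  simp only [Matrix.mulVec, dotProduct, Fintype.sum_prod_type, Finset.sum_mul_sum,
    Matrix.kroneckerMap_apply]
  exact Finset.sum_congr rfl fun _ _ => Finset.sum_congr rfl fun _ _ => by ring

theorem not_isEntangling_kronecker_mul_gateSwap {k : ℕ} (A B : Matrix (Bits k) (Bits k) ℂ) :
    ¬ IsEntangling ((A ⊗ₖ B) * gateSwap k) := by
  rintro ⟨ψ, φ, h⟩
  refine not_isEntangling_kronecker A B ⟨φ, ψ, fun ψ' φ' h' => h ψ' φ' ?_⟩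
  rw [← h', ← Matrix.mulVec_mulVec]
  congr 1
  funext x
  rw [Matrix.mulVec, dotProduct, Finset.sum_eq_single x.swap]
  · simp [gateSwap, mul_comm]
  · rintro ⟨u, u'⟩ _ hu
    have : ¬ (x.1 = u' ∧ x.2 = u) := fun h => hu (Prod.ext h.2.symm h.1.symm)
    simp [gateSwap, this]
  · simp

/-! ### Braids of equal 2-cycles -/

theorem exists_perm_of_maps {α β : Type*} [Finite α] (π : β ≃ β) {p q : α → β}
    (hp : Function.Injective p) (h : ∀ i, ∃ i', π (p i) = q i') :
    ∃ σ : Equiv.Perm α, ∀ i, π (p i) = q (σ i) := by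
  choose σ hσ using h
  have hinj : Function.Injective σ := fun i j hij =>
    hp (π.injective (by rw [hσ, hσ, hij]))
  exact ⟨Equiv.ofBijective σ (Finite.injective_iff_bijective.1 hinj), hσ⟩

section TwoCycle

variable {g : Symm}

/-- A braid that preserves the code permutes or exchanges the two groups of four twists. -/
theorem PreservesCode.exists_perm (hs : g.IsSwap) {β : Braid} (hβ : PreservesCode g g β) :
    ∃ σ τ : Equiv.Perm (Fin 4),
      (∀ i, β.perm (firstPos i) = firstPos (σ i) ∧ β.perm (secondPos i) = secondPos (τ i)) ∨
      (∀ i, β.perm (firstPos i) = secondPos (σ i) ∧ β.perm (secondPos i) = firstPos (τ i)) := by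
  have hg : g ≠ 1 := ne_one_of_isSwap hs
  set r := reduce hs (loop (fun _ => g) [3, 2, 1, 0] (zCharge g 0)) with hr
  have hr1 : ∀ i, r (firstPos i) = 1 := fun i => by
    rw [hr, (reduce_loop_first hs _).1,
      Anyon.moved_zCharge g hg (numQubits_eq_one_of_isSwap hs)]
  have hr2 : ∀ i, r (secondPos i) = 0 := (reduce_loop_first hs _).2
  obtain ⟨s, t, h1, h2⟩ := (mem_stabilizer_iff hs _).1 (hβ.stabilizer_mem _
    (AddSubgroup.subset_closure (Or.inl (Or.inr ⟨zCharge g 0, rfl⟩))))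
  rw [pairConfig_self hs] at h1 h2
  have hu : ∀ j, reduce hs (β.move (fun _ => g) (loop (fun _ => g) [3, 2, 1, 0] (zCharge g 0)))
      (β.perm j) = r j := reduce_move hs β _
  have hi1 : Function.Injective firstPos := Fin.castAdd_injective 4 4
  have hi2 : Function.Injective secondPos := Fin.natAdd_injective 4 4
  have hval : ∀ c : ZMod 2, c = 0 ∨ c = 1 := by decide
  -- Equal constants would give the original loop the same parity at all eight twists, but it
  -- encircles only the first four.
  by_cases hst : s = t
  · subst hst
    have hc : ∀ j, r j = s := fun j => by
      rw [← hu]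
      rcases firstPos_or_secondPos (β.perm j) with ⟨i, hi⟩ | ⟨i, hi⟩ <;> rw [hi]
      · exact h1 i
      · exact h2 i
    exact absurd ((hr1 0).symm.trans ((hc _).trans ((hc _).symm.trans (hr2 0)))) (by decide)
  · have hcase : (s = 1 ∧ t = 0) ∨ (s = 0 ∧ t = 1) := by
      rcases hval s with rfl | rfl <;> rcases hval t with rfl | rfl <;> simp_all
    rcases hcase with ⟨rfl, rfl⟩ | ⟨rfl, rfl⟩
    · obtain ⟨σ, hσ⟩ := exists_perm_of_maps β.perm hi1 (q := firstPos) fun i => by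
        refine (firstPos_or_secondPos (β.perm (firstPos i))).resolve_right ?_
        rintro ⟨j, hj⟩
        have := hu (firstPos i)
        rw [hj, h2, hr1] at this
        exact absurd this (by decide)
      obtain ⟨τ, hτ⟩ := exists_perm_of_maps β.perm hi2 (q := secondPos) fun i => by
        refine (firstPos_or_secondPos (β.perm (secondPos i))).resolve_left ?_
        rintro ⟨j, hj⟩
        have := hu (secondPos i)
        rw [hj, h1, hr2] at this
        exact absurd this (by decide)
      exact ⟨σ, τ, Or.inl fun i => ⟨hσ i, hτ i⟩⟩
    · obtain ⟨σ, hσ⟩ := exists_perm_of_maps β.perm hi1 (q := secondPos) fun i => by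
        refine (firstPos_or_secondPos (β.perm (firstPos i))).resolve_left ?_
        rintro ⟨j, hj⟩
        have := hu (firstPos i)
        rw [hj, h1, hr1] at this
        exact absurd this (by decide)
      obtain ⟨τ, hτ⟩ := exists_perm_of_maps β.perm hi2 (q := firstPos) fun i => by
        refine (firstPos_or_secondPos (β.perm (secondPos i))).resolve_right ?_
        rintro ⟨j, hj⟩
        have := hu (secondPos i)
        rw [hj, h2, hr2] at this
        exact absurd this (by decide)
      exact ⟨σ, τ, Or.inr fun i => ⟨hσ i, hτ i⟩⟩

variable [Unique (Fin (numQubits g))]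

/-- Independence of the logical Paulis modulo the stabilizer: the braid determines the image labels,
so any two implemented gates can be compared. -/
theorem eq_of_logicalPauli_sub_mem (hs : g.IsSwap) {v w v' w' : PauliLabel (numQubits g)}
    (h : logicalPauli g g v w - logicalPauli g g v' w' ∈ stabilizer g g) : v = v' ∧ w = w' := by
  obtain ⟨s, t, h1, h2⟩ := (mem_stabilizer_iff hs _).1 h
  simp only [map_sub, Pi.sub_apply, (reduce_logicalPauli hs _ _).1,
    (reduce_logicalPauli hs _ _).2] at h1 h2
  exact ⟨eq_of_labelVec_eq_add_const (c := s) fun i => by rw [← h1 i]; ring,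
    eq_of_labelVec_eq_add_const (c := t) fun i => by rw [← h2 i]; ring⟩

theorem move_logicalPauli_of_preserves_blocks (hs : g.IsSwap) {β : Braid}
    {σ τ : Equiv.Perm (Fin 4)}
    (h : ∀ i, β.perm (firstPos i) = firstPos (σ i) ∧ β.perm (secondPos i) = secondPos (τ i))
    (v w : PauliLabel (numQubits g)) :
    β.move (pairConfig g g) (logicalPauli g g v w) -
      logicalPauli g g (permLabel σ v) (permLabel τ w) ∈ stabilizer g g := by
  -- These constants undo the normalisation at the last twist of each block.
  refine (mem_stabilizer_iff hs _).2 ⟨-labelVec v (σ⁻¹ 3), -labelVec w (τ⁻¹ 3), fun i => ?_,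
    fun i => ?_⟩
  · have e : β.perm (firstPos (σ⁻¹ i)) = firstPos i := by rw [(h _).1]; simp
    rw [map_sub, Pi.sub_apply, (reduce_logicalPauli hs _ _).1, labelVec_permLabel, ← e,
      pairConfig_self hs, reduce_move, (reduce_logicalPauli hs _ _).1]
    ring
  · have e : β.perm (secondPos (τ⁻¹ i)) = secondPos i := by rw [(h _).2]; simp
    rw [map_sub, Pi.sub_apply, (reduce_logicalPauli hs _ _).2, labelVec_permLabel, ← e,
      pairConfig_self hs, reduce_move, (reduce_logicalPauli hs _ _).2]
    ring

theorem move_logicalPauli_of_exchanges_blocks (hs : g.IsSwap) {β : Braid}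
    {σ τ : Equiv.Perm (Fin 4)}
    (h : ∀ i, β.perm (firstPos i) = secondPos (σ i) ∧ β.perm (secondPos i) = firstPos (τ i))
    (v w : PauliLabel (numQubits g)) :
    β.move (pairConfig g g) (logicalPauli g g v w) -
      logicalPauli g g (permLabel τ w) (permLabel σ v) ∈ stabilizer g g := by
  refine (mem_stabilizer_iff hs _).2 ⟨-labelVec w (τ⁻¹ 3), -labelVec v (σ⁻¹ 3), fun i => ?_,
    fun i => ?_⟩
  · have e : β.perm (secondPos (τ⁻¹ i)) = firstPos i := by rw [(h _).2]; simp
    rw [map_sub, Pi.sub_apply, (reduce_logicalPauli hs _ _).1, labelVec_permLabel, ← e,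
      pairConfig_self hs, reduce_move, (reduce_logicalPauli hs _ _).2]
    ring
  · have e : β.perm (firstPos (σ⁻¹ i)) = secondPos i := by rw [(h _).1]; simp
    rw [map_sub, Pi.sub_apply, (reduce_logicalPauli hs _ _).2, labelVec_permLabel, ← e,
      pairConfig_self hs, reduce_move, (reduce_logicalPauli hs _ _).1]
    ring

theorem implements_kronecker (hs : g.IsSwap) {β : Braid} (hβ : PreservesCode g g β)
    {σ τ : Equiv.Perm (Fin 4)}
    (h : ∀ i, β.perm (firstPos i) = firstPos (σ i) ∧ β.perm (secondPos i) = secondPos (τ i))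
    {C D : Matrix (Bits (numQubits g)) (Bits (numQubits g)) ℂ} (hC : Conjugates C (permLabel σ))
    (hD : Conjugates D (permLabel τ)) : Implements g g β (C ⊗ₖ D) where
  preserves := hβ
  unitary := Matrix.kronecker_mem_unitary hC.1 hD.1
  conj v w := by
    obtain ⟨z, hz, e⟩ := hC.2 v
    obtain ⟨z', hz', e'⟩ := hD.2 w
    refine ⟨_, _, z' * z, by simp [hz, hz'], move_logicalPauli_of_preserves_blocks hs h v w, ?_⟩
    rw [kronecker_conj, e, e', Matrix.smul_kronecker, Matrix.kronecker_smul, smul_smul, mul_comm]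

theorem implements_kronecker_mul_gateSwap (hs : g.IsSwap) {β : Braid} (hβ : PreservesCode g g β)
    {σ τ : Equiv.Perm (Fin 4)}
    (h : ∀ i, β.perm (firstPos i) = secondPos (σ i) ∧ β.perm (secondPos i) = firstPos (τ i))
    {C D : Matrix (Bits (numQubits g)) (Bits (numQubits g)) ℂ} (hC : Conjugates C (permLabel σ))
    (hD : Conjugates D (permLabel τ)) :
    Implements g g β ((D ⊗ₖ C) * gateSwap (numQubits g)) where
  preserves := hβ
  unitary := mul_mem (Matrix.kronecker_mem_unitary hD.1 hC.1) (gateSwap_mem_unitaryGroup _)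
  conj v w := by
    obtain ⟨z, hz, e⟩ := hC.2 v
    obtain ⟨z', hz', e'⟩ := hD.2 w
    refine ⟨_, _, z * z', by simp [hz, hz'], move_logicalPauli_of_exchanges_blocks hs h v w, ?_⟩
    have hS : ∀ X Y Z S : Gate (numQubits g) (numQubits g), S * S = 1 →
        X * (Y * S) * (S * Z) = X * Y * Z := fun X Y Z S h1 => by
      rw [← mul_assoc X, mul_assoc (X * Y), ← mul_assoc S, h1, one_mul]
    rw [Matrix.conjTranspose_mul, gateSwap_conjTranspose, mul_assoc (D ⊗ₖ C),
      gateSwap_mul_kronecker, hS _ _ _ _ (gateSwap_mul_self _), kronecker_conj, e, e',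
      Matrix.smul_kronecker, Matrix.kronecker_smul, smul_smul, mul_comm]

/-- The implemented gate is unique up to Clifford gates that fix the Pauli operators. -/
theorem Implements.exists_eq_mul_kronecker (hs : g.IsSwap) {β : Braid}
    {U V : Gate (numQubits g) (numQubits g)} (hU : Implements g g β U)
    (hV : Implements g g β V) :
    ∃ A B, IsClifford A ∧ IsClifford B ∧ U = V * (A ⊗ₖ B) := by
  have hV1 : V * Vᴴ = 1 := Matrix.mem_unitaryGroup_iff.1 hV.unitary
  have hV2 : Vᴴ * V = 1 := Matrix.mem_unitaryGroup_iff'.1 hV.unitary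
  have hW : Vᴴ * U ∈ Matrix.unitaryGroup (Bits (numQubits g) × Bits (numQubits g)) ℂ :=
    mul_mem (Unitary.star_mem hV.unitary) hU.unitary
  obtain ⟨A, B, hA, hB, e⟩ := exists_kronecker_of_conj_pauli hW fun v w => by
    obtain ⟨v₁, w₁, z₁, hz₁, hm₁, e₁⟩ := hU.conj v w
    obtain ⟨v₂, w₂, z₂, hz₂, hm₂, e₂⟩ := hV.conj v w
    obtain ⟨rfl, rfl⟩ : v₂ = v₁ ∧ w₂ = w₁ := by
      refine eq_of_logicalPauli_sub_mem hs ?_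
      have := sub_mem hm₁ hm₂
      rwa [sub_sub_sub_cancel_left] at this
    have hz0 : z₂ ≠ 0 := fun h0 => by simp [h0] at hz₂
    refine ⟨z₁ * z₂⁻¹, by simp [hz₁, hz₂], ?_⟩
    have e₃ : pauli v₂ ⊗ₖ pauli w₂ = z₂⁻¹ • (V * (pauli v ⊗ₖ pauli w) * Vᴴ) := by
      rw [e₂, smul_smul, inv_mul_cancel₀ hz0, one_smul]
    calc Vᴴ * U * (pauli v ⊗ₖ pauli w) * (Vᴴ * U)ᴴ
        = Vᴴ * (U * (pauli v ⊗ₖ pauli w) * Uᴴ) * V := by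
          rw [Matrix.conjTranspose_mul, Matrix.conjTranspose_conjTranspose]
          simp only [mul_assoc]
      _ = (z₁ * z₂⁻¹) • (Vᴴ * V * (pauli v ⊗ₖ pauli w) * (Vᴴ * V)) := by
          rw [e₁, e₃, smul_smul, Matrix.mul_smul, Matrix.smul_mul]
          simp only [mul_assoc]
      _ = (z₁ * z₂⁻¹) • (pauli v ⊗ₖ pauli w) := by rw [hV2, one_mul, mul_one]
  exact ⟨A, B, hA, hB, by rw [← e, ← mul_assoc, hV1, one_mul]⟩

end TwoCycle

/-- The gates implemented by braids of two encodings by the same 2-cycle. -/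
theorem PreservesCode.implements_of_isSwap {g : Symm} (hs : g.IsSwap) {β : Braid}
    (hβ : PreservesCode g g β) :
    (∃ U, Implements g g β U) ∧ ∀ U, Implements g g β U →
      ∃ C₁ C₂ : Matrix (Bits (numQubits g)) (Bits (numQubits g)) ℂ,
        IsClifford C₁ ∧ IsClifford C₂ ∧
        (U = C₁ ⊗ₖ C₂ ∨ U = (C₁ ⊗ₖ C₂) * gateSwap (numQubits g)) ∧
        ((∀ k : Fin 8, k < 4 → β.perm k < 4) → U = C₁ ⊗ₖ C₂) := by
  have : Unique (Fin (numQubits g)) := by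
    rw [numQubits_eq_one_of_isSwap hs]; infer_instance
  obtain ⟨σ, τ, h⟩ := hβ.exists_perm hs
  obtain ⟨C, hC⟩ := exists_conjugates_permLabel (k := numQubits g) σ
  obtain ⟨D, hD⟩ := exists_conjugates_permLabel (k := numQubits g) τ
  rcases h with h | h
  · have hV := implements_kronecker hs hβ h hC hD
    refine ⟨⟨_, hV⟩, fun U hU => ?_⟩
    obtain ⟨A, B, hA, hB, e⟩ := hU.exists_eq_mul_kronecker hs hV
    rw [← Matrix.mul_kronecker_mul] at e
    exact ⟨C * A, D * B, hC.isClifford.mul hA, hD.isClifford.mul hB, Or.inl e, fun _ => e⟩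
  · have hV := implements_kronecker_mul_gateSwap hs hβ h hC hD
    refine ⟨⟨_, hV⟩, fun U hU => ?_⟩
    obtain ⟨A, B, hA, hB, e⟩ := hU.exists_eq_mul_kronecker hs hV
    rw [mul_assoc, gateSwap_mul_kronecker, ← mul_assoc, ← Matrix.mul_kronecker_mul] at e
    refine ⟨D * B, C * A, hD.isClifford.mul hB, hC.isClifford.mul hA, Or.inr e, fun hlt => ?_⟩
    -- Under an exchange of blocks, twist 0 lands in the second block, so the extra hypothesis is
    -- contradictory.
    have h0 := hlt (firstPos 0) (by decide)
    rw [(h 0).1] at h0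
    have : ∀ i, ¬ secondPos i < 4 := by decide
    exact absurd h0 (this _)

end ThreeFermion

end

theorem mainTheorem2 (g h : ThreeFermion.Symm) (hg : g ≠ 1) (hh : h ≠ 1) :
    ((∃ (β : ThreeFermion.Braid)
        (U : ThreeFermion.Gate (ThreeFermion.numQubits g) (ThreeFermion.numQubits h)),
        ThreeFermion.Implements g h β U ∧ ThreeFermion.IsEntangling U) ↔
      (g ≠ h ∨ g.IsThreeCycle ∨ h.IsThreeCycle)) ∧
    (g.IsSwap → h.IsSwap → g ≠ h →
      ∃ β : ThreeFermion.Braid, β.perm = 1 ∧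
        ∀ (i : Fin (ThreeFermion.numQubits g)) (j : Fin (ThreeFermion.numQubits h)),
          ThreeFermion.Implements g h β (ThreeFermion.gateCZ i j)) ∧
    (g.IsSwap → ∀ β : ThreeFermion.Braid, ThreeFermion.PreservesCode g g β →
      (∃ U, ThreeFermion.Implements g g β U) ∧
      ∀ U, ThreeFermion.Implements g g β U →
        ∃ C₁ C₂ : Matrix (ThreeFermion.Bits (ThreeFermion.numQubits g))
            (ThreeFermion.Bits (ThreeFermion.numQubits g)) ℂ,
          ThreeFermion.IsClifford C₁ ∧ ThreeFermion.IsClifford C₂ ∧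
          (U = Matrix.kronecker C₁ C₂ ∨
            U = Matrix.kronecker C₁ C₂ * ThreeFermion.gateSwap (ThreeFermion.numQubits g)) ∧
          ((∀ k : Fin 8, k < 4 → β.perm k < 4) → U = Matrix.kronecker C₁ C₂)) := by
  refine ⟨⟨?_, fun H => ?_⟩, fun hgs hhs hne => ?_, fun hgs β hβ =>
    ThreeFermion.PreservesCode.implements_of_isSwap hgs hβ⟩
  · rintro ⟨β, U, hU, hent⟩
    by_contra! H
    obtain ⟨rfl, h3, -⟩ := H
    have hs := ThreeFermion.isSwap_of_not_isThreeCycle hg h3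
    obtain ⟨C₁, C₂, -, -, hform, -⟩ :=
      (ThreeFermion.PreservesCode.implements_of_isSwap hs hU.preserves).2 U hU
    rcases hform with rfl | rfl
    · exact ThreeFermion.not_isEntangling_kronecker _ _ hent
    · exact ThreeFermion.not_isEntangling_kronecker_mul_gateSwap _ _ hent
  · rw [← ThreeFermion.numQubits_eq_two_iff, ← ThreeFermion.numQubits_eq_two_iff] at H
    obtain ⟨i, j, hij⟩ := ThreeFermion.exists_coupling_ne_zero g h hg hh H
    exact ⟨_, _, ThreeFermion.pairBraid_implements g h hg hh,
      ThreeFermion.phaseGate_isEntangling _ hij⟩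
  · refine ⟨ThreeFermion.pairBraid, ThreeFermion.pairBraid_perm, fun i j => ?_⟩
    have hsg : Subsingleton (Fin (ThreeFermion.numQubits g)) := by
      rw [ThreeFermion.numQubits_eq_one_of_isSwap hgs]; infer_instance
    have hsh : Subsingleton (Fin (ThreeFermion.numQubits h)) := by
      rw [ThreeFermion.numQubits_eq_one_of_isSwap hhs]; infer_instance
    -- For 2-cycles the coupling is a single nonzero bit, so the phase gate is CZ itself.
    obtain ⟨i', j', hij⟩ := ThreeFermion.exists_coupling_ne_zero g h hg hh (Or.inl hne)
    have hone : ∀ b : ZMod 2, b ≠ 0 → b = 1 := by decide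
    rw [ThreeFermion.gateCZ_eq_phaseGate i j (Matrix.of (ThreeFermion.coupling g h))
      (by rw [Subsingleton.elim i i', Subsingleton.elim j j']; exact hone _ hij)]
    exact ThreeFermion.pairBraid_implements g h hg hh
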